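/- **Setting.** Let $\Omega=\prod_{i=1}^d(\mathbb R/\ell_i\mathbb Z)$, $\ell_i>0$, be a $d$-dimensional periodic box with Lebesgue measure, $T>0$, and write $(u,v)=\int_\Omega u\cdot v\,dx$, where for matrices the product is the Frobenius product $A:B$. Let $L(\Xi)_i=\sum_{j=0}^{\nu}\sum_{l,m=1}^N\sum_{|\alpha|=j}b_{ilm\alpha}\,\partial_\alpha\Xi_{lm}$, $i=1,\dots,n$, be a differential operator with constant real coefficients acting on fields $\Xi$ on $\Omega$ of symmetric matrices in $\mathbb R^{N\times N}_s$, and let $L^*$ be its adjoint. Let $\Lambda\subset\mathbb R^{N\times N}_s$ be the smallest linear subspace that contains $I$ and all values $L^*(u)(x)$, $u:\Omega\to\mathbb R^n$ smooth, $x\in\Omega$, and let $\pi_\Lambda$ be the Frobenius-orthogonal projection onto $\Lambda$. For $A,B\in\mathbb R^{N\times N}_s$ write $A\preceq B$ if $B-A$ is nonnegative definite, and $A\le B$ if $(B-A):P\ge0$ for all $P\in\Lambda$ with $P\succeq0$. A Young function is a convex even $\Phi:\mathbb R\to[0,\infty)$ with $\Phi(s)=0$ iff $s=0$, $\Phi(s)/s\to0$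 as $s\to0$ and $\Phi(s)/s\to\infty$ as $s\to+\infty$. An $N$-function is a convex even $\mathbf K:\mathbb R^n\to[0,\infty)$ with $\Phi_-(|y|)\le\mathbf K(y)\le\Phi_+(|y|)$ for some Young functions $\Phi_\pm$. It satisfies the $\Delta_2$-condition if $\mathbf K(2y)\le C(\mathbf K(y)+1)$ for some constant $C$ and all $y$. $L_{\mathbf K}(Q;\mathbb R^n)$ is the set of measurable $f:Q\to\mathbb R^n$ with $\int_Q\mathbf K(f)\,dx<\infty$, and $\mathbf K^*$ is the Legendre transform of $\mathbf K$. **Assumptions.** $\mathbf F:\mathbb R^n\to\mathbb R^{N\times N}_s$ is $C^2$, and $\mathbf K(v):=\frac12\operatorname{tr}(\mathbf F(v)-\mathbf F(0))$ is a strictly convex $N$-function such that $\mathbf K$ and $\mathbf K^*$ satisfy the $\Delta_2$-condition. For each $P\in\Lambda$ with $P\succeq0$ the function $\mathbf F:P$ is convex. Moreover $\mathbf F(v)\ge0$ for all $v$, and $|\pi_\Lambda\partial_{v_l}\mathbf F(v)|\le C(|\nabla\mathbf K(v)|+1)$ for some constant $C$, all $v$ and all $l$. The weight $\kappa:[0,T]\to(0,\infty)$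 is measurable and bounded away from $0$ and $\infty$. **Strong trace condition.** Let $D(L^*)$ be the set of those $\zeta\in L_{\mathbf K^*}(\Omega;\mathbb R^n)$ for which there is $G=:L^*\zeta\in L^\infty(\Omega;\mathbb R^{N\times N}_s)$ with $(\zeta,L\Psi)=(G,\Psi)$ for all smooth $\Psi:\Omega\to\mathbb R^{N\times N}_s$. $L$ satisfies the strong trace condition if there is a constant $c$ such that for every $\zeta\in D(L^*)$ and every $k\in\mathbb R$: if the eigenvalues of $-L^*\zeta(x)$ are at most $k$ for a.e. $x\in\Omega$, then the eigenvalues of $L^*\zeta(x)$ are at most $ck$ for a.e. $x\in\Omega$. **Dual problem.** For $(E,B)\in L_{\mathbf K^*}((0,T)\times\Omega;\mathbb R^n)\times L^\infty((0,T)\times\Omega;\mathbb R^{N\times N}_s)$ let $$\mathcal K(E,B)=\inf\int_0^T\Big[(z,E)+\tfrac12(M,\kappa I+2B)\Big]\,dt\in[-\infty,\infty),$$ the infimum being over all $(z,M)\in L_{\mathbf K}((0,T)\times\Omega;\mathbb R^n)\times L^1((0,T)\times\Omega;\mathbb R^{N\times N}_s)$ with $\mathbf F(z)\le M$ a.e.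 For $v_0\in L_{\mathbf K}(\Omega;\mathbb R^n)$ the dual problem is $$\tilde{\mathcal J}(v_0,T)=\sup_{(E,B)}\Big\{-\int_0^T(v_0,E)\,dt+\mathcal K(E,B)\Big\},$$ the supremum being over all pairs $(E,B)$ of the above class that satisfy $\kappa I+2B\succeq0$ a.e. in $(0,T)\times\Omega$ and $\int_0^T[(B,\partial_t\Psi)+(E,L\Psi)]\,dt=0$ for all smooth $\Psi:[0,T]\times\Omega\to\mathbb R^{N\times N}_s$ with $\Psi(0,\cdot)=0$. **Theorem (Existence in anisotropic Orlicz spaces).** Assume that $L$ satisfies the strong trace condition. Then for every $v_0\in L_{\mathbf K}(\Omega;\mathbb R^n)$ the dual problem has a maximizer $(E,B)\in L_{\mathbf K^*}((0,T)\times\Omega;\mathbb R^n)\times L^\infty((0,T)\times\Omega;\mathbb R^{N\times N}_s)$, and $$0\le\frac{|\Omega|\operatorname{tr}\mathbf F(0)}2\int_0^T\kappa(s)\,ds\le\tilde{\mathcal J}(v_0,T)<\infty.$$ -/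

import Mathlib

open MeasureTheory Set Filter Topology
open scoped ContDiff ENNReal

noncomputable section

namespace DualOrlicz

/-! ### Young functions, N-functions, Orlicz classes -/

/-- The space `ℝⁿ` with its Euclidean norm. -/
abbrev Vec (n : ℕ) : Type := EuclideanSpace ℝ (Fin n)

/-- Young function `Φ : ℝ → ℝ₊`. -/
structure IsYoung (Φ : ℝ → ℝ) : Prop where
  nonneg : ∀ s, 0 ≤ Φ s
  convex : ConvexOn ℝ univ Φ
  even : ∀ s, Φ (-s) = Φ s
  eq_zero_iff : ∀ s, Φ s = 0 ↔ s = 0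
  lim_zero : Tendsto (fun s => Φ s / s) (𝓝[≠] 0) (𝓝 0)
  lim_top : Tendsto (fun s => Φ s / s) atTop atTop

/-- `N`-function on `ℝⁿ`. -/
structure IsNFunction {n : ℕ} (K : Vec n → ℝ) : Prop where
  nonneg : ∀ y, 0 ≤ K y
  convex : ConvexOn ℝ univ K
  even : ∀ y, K (-y) = K y
  between : ∃ Φ₁ Φ₂ : ℝ → ℝ, IsYoung Φ₁ ∧ IsYoung Φ₂ ∧ ∀ y, Φ₁ ‖y‖ ≤ K y ∧ K y ≤ Φ₂ ‖y‖

/-- The `Δ₂`-condition `K(2y) ≲ K(y) + 1`. -/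
def Delta2 {n : ℕ} (K : Vec n → ℝ) : Prop :=
  ∃ C : ℝ, ∀ y, K ((2 : ℝ) • y) ≤ C * (K y + 1)

/-- The Legendre transform `K*(y) = sup_v (v · y - K(v))`; the supremum is finite for an
`N`-function. -/
def conj {n : ℕ} (K : Vec n → ℝ) (y : Vec n) : ℝ :=
  ⨆ v : Vec n, (inner ℝ v y - K v)

/-- Membership in the anisotropic Orlicz class `L_K(Q; ℝⁿ)`: measurable with finite modular
`∫ K(f)`. -/
def MemOrlicz {Q : Type*} [MeasurableSpace Q] {n : ℕ} (K : Vec n → ℝ) (f : Q → Vec n)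
    (μ : Measure Q) : Prop :=
  AEStronglyMeasurable f μ ∧ Integrable (fun q => K (f q)) μ

/-! ### Matrices -/

/-- Real `N × N` matrices. -/
abbrev Mat (N : ℕ) : Type := Matrix (Fin N) (Fin N) ℝ

/-- The Frobenius product `A : B`. -/
def frob {N : ℕ} (A B : Mat N) : ℝ := ∑ l, ∑ m, A l m * B l m

/-- All (real) eigenvalues of `A` are at most `k`. -/
def EigenvaluesLE {N : ℕ} (A : Mat N) (k : ℝ) : Prop :=
  ∀ μ ∈ spectrum ℝ A, μ ≤ k

/-! ### The periodic box and differential operators with constant coefficients -/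

/-- The periodic box with side lengths `ℓ i`; its `volume` is the Lebesgue measure of total
mass `∏ ℓ i`. -/
abbrev Torus {d : ℕ} (ℓ : Fin d → ℝ) : Type := (i : Fin d) → AddCircle (ℓ i)

/-- The covering map `ℝᵈ → Ω`. -/
def proj {d : ℕ} (ℓ : Fin d → ℝ) (y : Fin d → ℝ) : Torus ℓ := fun i => (y i : AddCircle (ℓ i))

/-- Smooth functions on the periodic box: the periodic lift to `ℝᵈ` is smooth. -/
def Smooth {d : ℕ} {ℓ : Fin d → ℝ} (f : Torus ℓ → ℝ) : Prop :=
  ContDiff ℝ ∞ (fun y : Fin d → ℝ => f (proj ℓ y))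

/-- `∂ᵢ f`. -/
def partialDeriv {d : ℕ} {ℓ : Fin d → ℝ} (i : Fin d) (f : Torus ℓ → ℝ) : Torus ℓ → ℝ :=
  fun x => deriv (fun s : ℝ => f (x + Pi.single i (s : AddCircle (ℓ i)))) 0

/-- `∂_α f` for a multiindex `α`. -/
def multiDeriv {d : ℕ} {ℓ : Fin d → ℝ} (α : Fin d → ℕ) (f : Torus ℓ → ℝ) : Torus ℓ → ℝ :=
  (List.finRange d).foldr (fun i g => (partialDeriv i)^[α i] g) f

/-- The finite set of multiindices `α` with `|α| = j`. -/
def multiIndices (d j : ℕ) : Finset (Fin d → ℕ) := Finset.piAntidiag Finset.univ j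

/-- A differential operator with constant coefficients `b_{ilmα}`, of order at most `ν`. -/
structure DiffOp (d n N : ℕ) where
  order : ℕ
  coeff : Fin n → Fin N → Fin N → (Fin d → ℕ) → ℝ

/-- `L(Ξ)_i = ∑_{j ≤ ν} ∑_{l,m} ∑_{|α| = j} b_{ilmα} ∂_α Ξ_{lm}`. -/
def DiffOp.apply {d n N : ℕ} (L : DiffOp d n N) {ℓ : Fin d → ℝ} (Ξ : Torus ℓ → Mat N)
    (x : Torus ℓ) : Vec n :=
  WithLp.toLp 2 fun i => ∑ j ∈ Finset.range (L.order + 1), ∑ l, ∑ m,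
    ∑ α ∈ multiIndices d j, L.coeff i l m α * multiDeriv α (fun y => Ξ y l m) x

/-- The adjoint differential operator before symmetrization,
`∑_{j ≤ ν} ∑_i ∑_{|α| = j} (-1)^j b_{ilmα} ∂_α u_i`. -/
def DiffOp.preAdjoint {d n N : ℕ} (L : DiffOp d n N) {ℓ : Fin d → ℝ} (u : Torus ℓ → Vec n)
    (x : Torus ℓ) : Mat N :=
  Matrix.of fun l m => ∑ j ∈ Finset.range (L.order + 1), ∑ i,
    ∑ α ∈ multiIndices d j, (-1 : ℝ) ^ j * L.coeff i l m α * multiDeriv α (fun y => u y i) x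

/-- The adjoint differential operator `L*` on smooth functions. As `L` acts on fields of symmetric
matrices, `L*` takes symmetric values. -/
def DiffOp.adjoint {d n N : ℕ} (L : DiffOp d n N) {ℓ : Fin d → ℝ} (u : Torus ℓ → Vec n)
    (x : Torus ℓ) : Mat N :=
  (1 / 2 : ℝ) • (L.preAdjoint u x + (L.preAdjoint u x).transpose)

/-- `Λ`: the smallest linear subspace of the symmetric matrices that contains `I` and all the values
`L*(u)(x)`, `u` smooth. -/
def DiffOp.Lam {d n N : ℕ} (L : DiffOp d n N) (ℓ : Fin d → ℝ) : Submodule ℝ (Mat N) :=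
  Submodule.span ℝ ({1} ∪ {P | ∃ u : Torus ℓ → Vec n, (∀ i, Smooth (fun y => u y i)) ∧
    ∃ x, P = L.adjoint u x})

/-- The cone `{Ξ symmetric | Ξ : P ≥ 0 for all P ∈ Λ, P ⪰ 0}`. -/
def LamCone {N : ℕ} (Λ : Submodule ℝ (Mat N)) : Set (Mat N) :=
  {Ξ | Ξ.IsSymm ∧ ∀ P ∈ Λ, P.PosSemidef → 0 ≤ frob Ξ P}

/-- `A ≤ B` in the `Λ`-order. -/
def LamLE {N : ℕ} (Λ : Submodule ℝ (Mat N)) (A B : Mat N) : Prop := B - A ∈ LamCone Λ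

/-- `R` is the orthogonal projection of `A` to `Λ` with respect to the Frobenius product. -/
def IsLamProj {N : ℕ} (Λ : Submodule ℝ (Mat N)) (A R : Mat N) : Prop :=
  R ∈ Λ ∧ ∀ P ∈ Λ, frob (A - R) P = 0

/-! ### Assumptions on the flux -/

/-- The entropy `K(v) = tr (F(v) - F(0)) / 2`. -/
def entropy {n N : ℕ} (F : Vec n → Mat N) (v : Vec n) : ℝ := (F v - F 0).trace / 2

/-- `∂_l F(v)`, entrywise. -/
def fluxDeriv {n N : ℕ} (F : Vec n → Mat N) (l : Fin n) (v : Vec n) : Mat N :=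
  Matrix.of fun a b => lineDeriv ℝ (fun w => F w a b) v (EuclideanSpace.single l 1)

/-- The assumptions on the flux matrix `F`, relative to a subspace `Λ`. -/
structure IsAdmissibleFlux {n N : ℕ} (Λ : Submodule ℝ (Mat N)) (F : Vec n → Mat N) : Prop where
  symm : ∀ v, (F v).IsSymm
  contDiff : ∀ a b, ContDiff ℝ 2 (fun v => F v a b)
  entropy_strictConvex : StrictConvexOn ℝ univ (entropy F)
  entropy_nFunction : IsNFunction (entropy F)
  entropy_delta2 : Delta2 (entropy F)
  conj_delta2 : Delta2 (conj (entropy F))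
  /-- `Λ`-convexity. -/
  lam_convex : ∀ P ∈ Λ, P.PosSemidef → ConvexOn ℝ univ (fun v => frob (F v) P)
  /-- Positivity in the `Λ`-order. -/
  lam_nonneg : ∀ v, F v ∈ LamCone Λ
  /-- `|π_Λ ∂_l F(v)| ≲ |∇K(v)| + 1`. -/
  deriv_bound : ∃ C : ℝ, ∀ v l, ∀ R, IsLamProj Λ (fluxDeriv F l v) R →
    Real.sqrt (frob R R) ≤ C * (‖gradient (entropy F) v‖ + 1)

/-! ### The strong trace condition -/

/-- `ζ ∈ D(L*)` and `L* ζ = G`, where `L*` is the adjoint of the operator `L` defined on smooth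
fields: `ζ ∈ L_{K*}(Ω; ℝⁿ)`, `G ∈ L^∞(Ω; ℝ^{N×N}_s)`, and `(ζ, L Ψ) = (G, Ψ)` for all smooth `Ψ`. -/
structure IsAdjointValue {d n N : ℕ} {ℓ : Fin d → ℝ} [∀ i, Fact (0 < ℓ i)] (L : DiffOp d n N)
    (K : Vec n → ℝ) (ζ : Torus ℓ → Vec n) (G : Torus ℓ → Mat N) : Prop where
  mem_orlicz : MemOrlicz (conj K) ζ volume
  memLp : ∀ l m, MemLp (fun x => G x l m) ∞ volume
  symm : ∀ᵐ x, (G x).IsSymm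
  adjoint : ∀ Ψ : Torus ℓ → Mat N, (∀ x, (Ψ x).IsSymm) → (∀ l m, Smooth (fun x => Ψ x l m)) →
    ∫ x, inner ℝ (ζ x) (L.apply Ψ x) = ∫ x, frob (G x) (Ψ x)

/-- The strong trace condition. -/
def StrongTrace {d n N : ℕ} (ℓ : Fin d → ℝ) [∀ i, Fact (0 < ℓ i)] (L : DiffOp d n N)
    (K : Vec n → ℝ) : Prop :=
  ∃ c : ℝ, ∀ (ζ : Torus ℓ → Vec n) (G : Torus ℓ → Mat N), IsAdjointValue L K ζ G →
    ∀ k : ℝ, (∀ᵐ x, EigenvaluesLE (-(G x)) k) → ∀ᵐ x, EigenvaluesLE (G x) (c * k)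

/-! ### The dual problem -/

/-- Lebesgue measure on `(0,T) × Ω`. -/
def spaceTime {d : ℕ} (ℓ : Fin d → ℝ) [∀ i, Fact (0 < ℓ i)] (T : ℝ) :
    Measure (ℝ × Torus ℓ) :=
  (volume.restrict (Ioo 0 T)).prod volume

/-- Smooth symmetric matrix fields `Ψ` with `Ψ(0) = 0` (the smooth fields on `[0,T] × Ω` are the
restrictions of the smooth fields on `ℝ × Ω`). -/
structure IsTestField {d N : ℕ} {ℓ : Fin d → ℝ} (Ψ : ℝ → Torus ℓ → Mat N) : Prop where
  symm : ∀ t x, (Ψ t x).IsSymm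
  smooth : ∀ l m, ContDiff ℝ ∞ (fun p : ℝ × (Fin d → ℝ) => Ψ p.1 (proj ℓ p.2) l m)
  initial : ∀ x, Ψ 0 x = 0

/-- `∂_t Ψ`, entrywise. -/
def timeDeriv {d N : ℕ} {ℓ : Fin d → ℝ} (Ψ : ℝ → Torus ℓ → Mat N) (t : ℝ) (x : Torus ℓ) : Mat N :=
  Matrix.of fun l m => deriv (fun s => Ψ s x l m) t

/-- The weak form of `∂_t B = L* E`, `B(T) = 0`:
`∫₀ᵀ [(B, ∂_t Ψ) + (E, L Ψ)] dt = 0` for all smooth `Ψ` with `Ψ(0) = 0`. -/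
def WeakConstraint {d n N : ℕ} {ℓ : Fin d → ℝ} [∀ i, Fact (0 < ℓ i)] (L : DiffOp d n N) (T : ℝ)
    (E : ℝ × Torus ℓ → Vec n) (B : ℝ × Torus ℓ → Mat N) : Prop :=
  ∀ Ψ : ℝ → Torus ℓ → Mat N, IsTestField Ψ →
    ∫ p, (frob (B p) (timeDeriv Ψ p.1 p.2) + inner ℝ (E p) (L.apply (Ψ p.1) p.2))
      ∂(spaceTime ℓ T) = 0

/-- The pairs `(E,B)` in `L_{K*}((0,T)×Ω; ℝⁿ) × L^∞((0,T)×Ω; ℝ^{N×N}_s)` that satisfy the weak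
constraint and `κ I + 2 B ⪰ 0` a.e. -/
structure IsDualFeasible {d n N : ℕ} {ℓ : Fin d → ℝ} [∀ i, Fact (0 < ℓ i)] (L : DiffOp d n N)
    (F : Vec n → Mat N) (κ : ℝ → ℝ) (T : ℝ)
    (E : ℝ × Torus ℓ → Vec n) (B : ℝ × Torus ℓ → Mat N) : Prop where
  mem_orlicz : MemOrlicz (conj (entropy F)) E (spaceTime ℓ T)
  memLp : ∀ l m, MemLp (fun p => B p l m) ∞ (spaceTime ℓ T)
  symm : ∀ᵐ p ∂(spaceTime ℓ T), (B p).IsSymm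
  constraint : WeakConstraint L T E B
  posSemidef : ∀ᵐ p ∂(spaceTime ℓ T), (κ p.1 • (1 : Mat N) + (2 : ℝ) • B p).PosSemidef

/-- The pairs `(z,M)` in `L_K((0,T)×Ω; ℝⁿ) × L¹((0,T)×Ω; ℝ^{N×N}_s)` with `F(z) ≤ M` a.e. in the
`Λ`-order. -/
structure IsPrimalPair {d n N : ℕ} {ℓ : Fin d → ℝ} [∀ i, Fact (0 < ℓ i)] (L : DiffOp d n N)
    (F : Vec n → Mat N) (T : ℝ)
    (z : ℝ × Torus ℓ → Vec n) (M : ℝ × Torus ℓ → Mat N) : Prop where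
  mem_orlicz : MemOrlicz (entropy F) z (spaceTime ℓ T)
  integrable : ∀ l m, Integrable (fun p => M p l m) (spaceTime ℓ T)
  symm : ∀ᵐ p ∂(spaceTime ℓ T), (M p).IsSymm
  flux_le : ∀ᵐ p ∂(spaceTime ℓ T), LamLE (L.Lam ℓ) (F (z p)) (M p)

/-- `𝒦(E,B) = inf_{F(z) ≤ M} ∫₀ᵀ [(z,E) + (M, κ I + 2 B)/2] dt`, with values in `[-∞,∞]`. -/
def innerValue {d n N : ℕ} {ℓ : Fin d → ℝ} [∀ i, Fact (0 < ℓ i)] (L : DiffOp d n N)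
    (F : Vec n → Mat N) (κ : ℝ → ℝ) (T : ℝ)
    (E : ℝ × Torus ℓ → Vec n) (B : ℝ × Torus ℓ → Mat N) : EReal :=
  ⨅ (z : ℝ × Torus ℓ → Vec n) (M : ℝ × Torus ℓ → Mat N) (_ : IsPrimalPair L F T z M),
    ((∫ p, (inner ℝ (z p) (E p) + frob (M p) (κ p.1 • (1 : Mat N) + (2 : ℝ) • B p) / 2)
      ∂(spaceTime ℓ T) : ℝ) : EReal)

/-- The dual objective `-∫₀ᵀ (v₀,E) dt + 𝒦(E,B)`. -/
def dualObjective {d n N : ℕ} {ℓ : Fin d → ℝ} [∀ i, Fact (0 < ℓ i)] (L : DiffOp d n N)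
    (F : Vec n → Mat N) (κ : ℝ → ℝ) (T : ℝ) (v₀ : Torus ℓ → Vec n)
    (E : ℝ × Torus ℓ → Vec n) (B : ℝ × Torus ℓ → Mat N) : EReal :=
  ((-∫ p, inner ℝ (v₀ p.2) (E p) ∂(spaceTime ℓ T) : ℝ) : EReal) + innerValue L F κ T E B

/-- The optimal value of the dual problem, the supremum of the dual objective over the feasible
pairs. -/
def dualValue {d n N : ℕ} {ℓ : Fin d → ℝ} [∀ i, Fact (0 < ℓ i)] (L : DiffOp d n N)
    (F : Vec n → Mat N) (κ : ℝ → ℝ) (T : ℝ) (v₀ : Torus ℓ → Vec n) : EReal :=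
  ⨆ (E : ℝ × Torus ℓ → Vec n) (B : ℝ × Torus ℓ → Mat N) (_ : IsDualFeasible L F κ T E B),
    dualObjective L F κ T v₀ E B

/-- A weight on `[0,T]`: measurable, bounded away from `0` and `∞`. -/
structure IsWeight (κ : ℝ → ℝ) (T : ℝ) : Prop where
  measurable : AEStronglyMeasurable κ (volume.restrict (Icc 0 T))
  lower : ∃ a : ℝ, 0 < a ∧ ∀ t ∈ Icc 0 T, a ≤ κ t
  upper : ∃ b : ℝ, ∀ t ∈ Icc 0 T, κ t ≤ b

end DualOrlicz

end

/-! The proof is the direct method for a concave maximization problem, with an almost everywhere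
convergent selection in place of weak compactness.

Bound for `B`. The pointwise constraint says that the eigenvalues of -B are at most κ/2. Testing the
weak constraint with products h(t)Ψ(x) shows that weighted time averages of B are values of L*
(`isAdjointValue_integral`). The strong trace condition therefore turns the lower bound into an
upper one, and letting the weights concentrate bounds tr B uniformly (`exists_trace_le`). The
entries of the positive semidefinite matrix κI + 2B are bounded by its trace, so all feasible B lie
in one ball of L^∞.

Bound for `E`. The objective is an infimum over (z,M) of Lagrangians that are affine in (E,B)
(`le_dualObjective_iff`). Since F ≥ 0 in the Λ-order, M = tr F(z) I is admissible. Then z = v₀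
bounds the optimal value from above, and z = v₀ - w/2, with w nearly optimal in the Legendre
transform at a multiple of E, bounds ∫ K*(E) on superlevel sets (`exists_integral_conj_le`). The
zero pair is feasible and gives the lower bound for the value.

Attainment. The superlevel sets to levels increasing to the optimal value form a decreasing sequence
of convex sets bounded in L¹. Near-minimizers over them of the strictly convex functional ∫ √(1 +
|f|²) converge almost everywhere along a subsequence (`exists_seq_mem_tendsto_ae`). By the
Δ₂-condition for K each Lagrangian is continuous along this sequence (`tendsto_integral_inner`,
`tendsto_lagrangian`). Hence the limit is feasible, and it reaches the optimal value. -/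

noncomputable section

namespace DualOrlicz

/-! ### Almost everywhere convergent selections from decreasing convex sets of functions -/

section Selection

variable {H : Type*} [NormedAddCommGroup H]

/-- The vector `(1, y)`. -/
def homog (y : H) : WithLp 2 (ℝ × H) := WithLp.toLp 2 (1, y)

lemma continuous_homog : Continuous (homog : H → WithLp 2 (ℝ × H)) := by
  unfold homog
  exact (WithLp.prod_continuous_toLp 2 ℝ H).comp (by fun_prop)

lemma one_le_norm_homog (y : H) : 1 ≤ ‖homog y‖ := by
  rw [homog, WithLp.prod_norm_eq_of_L2]
  apply Real.le_sqrt_of_sq_le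
  simp

lemma norm_homog_le (y : H) : ‖homog y‖ ≤ 1 + ‖y‖ := by
  rw [homog, WithLp.prod_norm_eq_of_L2]
  apply Real.sqrt_le_iff.2
  simp
  constructor
  · positivity
  · nlinarith [norm_nonneg y]

variable {α : Type*} [MeasurableSpace α] {μ : Measure α} [IsFiniteMeasure μ]

lemma integrable_homog {f : α → H} (hf : Integrable f μ) :
    Integrable (fun x => homog (f x)) μ := by
  refine Integrable.mono' ((integrable_const (1 : ℝ)).add hf.norm)
    (continuous_homog.comp_aestronglyMeasurable hf.1) ?_
  exact Eventually.of_forall fun x => by simpa using norm_homog_le (f x)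

variable [InnerProductSpace ℝ H]

lemma homog_midpoint (y z : H) :
    homog ((1 / 2 : ℝ) • (y + z)) = (1 / 2 : ℝ) • (homog y + homog z) := by
  simp only [homog, ← WithLp.toLp_add, ← WithLp.toLp_smul]
  congr 1
  ext <;> simp
  norm_num

/-- Quantitative strict convexity of the norm across directions: the defect in the triangle
inequality controls the angle. It rests on 2(|A||B| - A·B) = (|A| + |B|)² - |A + B|², whose second
factor |A| + |B| + |A + B| is at most 4|A||B| because both norms are at least 1. -/
lemma norm_normalize_sub_sq_le (A B : H) (hA : 1 ≤ ‖A‖) (hB : 1 ≤ ‖B‖) :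
    ‖‖A‖⁻¹ • A - ‖B‖⁻¹ • B‖ ^ 2 ≤ 4 * (‖A‖ + ‖B‖ - ‖A + B‖) := by
  have h1 := norm_add_sq_real A B
  have h2 := norm_add_le A B
  have h3 : ‖‖A‖⁻¹ • A - ‖B‖⁻¹ • B‖ ^ 2
      = 2 * (‖A‖ * ‖B‖ - inner ℝ A B) / (‖A‖ * ‖B‖) := by
    rw [norm_sub_sq_real, inner_smul_left, inner_smul_right, norm_smul, norm_smul]
    simp only [norm_inv, norm_norm, conj_trivial]
    field_simp
    ring
  rw [h3, div_le_iff₀ (by positivity)]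
  set a := ‖A‖
  set b := ‖B‖
  set c := ‖A + B‖
  set s := inner ℝ A B
  have h4 : 2 * (a * b - s) = (a + b - c) * (a + b + c) := by nlinarith
  have h5 : a + b + c ≤ 4 * (a * b) := by nlinarith
  rw [h4]
  have h6 : 0 ≤ a + b - c := by linarith
  nlinarith [mul_le_mul_of_nonneg_left h5 h6]

/-- The infima of ∫ √(1 + |f|²) over the sets `S k` increase to a finite limit. Midpoints of later
near-minimizers stay in `S k`, so they cannot fall below its infimum, and the convexity defect is
forced to be small. -/
lemma exists_near_minimizers (S : ℕ → Set (α → H)) (hanti : Antitone S)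
    (hne : ∀ k, (S k).Nonempty)
    (hmid : ∀ k, ∀ f ∈ S k, ∀ g ∈ S k, (fun x => (1 / 2 : ℝ) • (f x + g x)) ∈ S k)
    (hint : ∀ f ∈ S 0, Integrable f μ) (C : ℝ) (hC : ∀ f ∈ S 0, ∫ x, ‖f x‖ ∂μ ≤ C) :
    ∃ (f : ℕ → α → H) (ε : ℕ → ℝ), (∀ k, f k ∈ S k) ∧ Tendsto ε atTop (𝓝 0) ∧
      ∀ k, ∀ j, k ≤ j → ∀ i, k ≤ i →
      ∫ x, (‖homog (f i x)‖ + ‖homog (f j x)‖ - ‖homog (f i x) + homog (f j x)‖) ∂μ ≤ ε k := by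
  set Φ : (α → H) → ℝ := fun f => ∫ x, ‖homog (f x)‖ ∂μ with hΦ
  have hsub : ∀ k, S k ⊆ S 0 := fun k => hanti (Nat.zero_le k)
  have hΦ0 : ∀ f, 0 ≤ Φ f := fun f => integral_nonneg fun x => norm_nonneg _
  have hbdd : ∀ k, BddBelow (Φ '' S k) := fun k => ⟨0, by rintro _ ⟨f, -, rfl⟩; exact hΦ0 f⟩
  have hΦC : ∀ f ∈ S 0, Φ f ≤ μ.real univ + C := by
    intro f hf
    calc Φ f ≤ ∫ x, (1 + ‖f x‖) ∂μ :=
          integral_mono (integrable_homog (hint f hf)).norm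
            ((integrable_const _).add (hint f hf).norm) fun x => norm_homog_le _
      _ = μ.real univ + ∫ x, ‖f x‖ ∂μ := by
          rw [integral_add (integrable_const _) (hint f hf).norm]; simp
      _ ≤ _ := by linarith [hC f hf]
  set m : ℕ → ℝ := fun k => sInf (Φ '' S k) with hm
  have hmono : Monotone m := fun i j hij =>
    csInf_le_csInf (hbdd i) ((hne j).image _) (image_mono (hanti hij))
  have hmle : ∀ k, ∀ f ∈ S k, m k ≤ Φ f := fun k f hf => csInf_le (hbdd k) ⟨f, hf, rfl⟩
  have hbda : BddAbove (range m) := by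
    refine ⟨μ.real univ + C, ?_⟩
    rintro _ ⟨k, rfl⟩
    obtain ⟨f, hf⟩ := hne k
    exact (hmle k f hf).trans (hΦC f (hsub k hf))
  have hlim := tendsto_atTop_ciSup hmono hbda
  set M := ⨆ k, m k
  have hex : ∀ k : ℕ, ∃ f ∈ S k, Φ f < m k + 1 / ((k : ℝ) + 1) := by
    intro k
    obtain ⟨_, ⟨f, hf, rfl⟩, h⟩ := exists_lt_of_csInf_lt ((hne k).image Φ)
      (show sInf (Φ '' S k) < m k + 1 / ((k : ℝ) + 1) by
        simp only [hm]; linarith [Nat.one_div_pos_of_nat (α := ℝ) (n := k)])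
    exact ⟨f, hf, h⟩
  choose f hfS hfm using hex
  -- Both near-minimizers have value at most M + 1/(k+1), and twice the value at their midpoint is
  -- at least 2 m k.
  refine ⟨f, fun k => 2 * (M - m k) + 2 * (1 / ((k : ℝ) + 1)), hfS, ?_, ?_⟩
  · have h1 := (tendsto_const_nhds (x := M)).sub hlim
    have h2 := (h1.const_mul 2).add
      ((tendsto_one_div_add_atTop_nhds_zero_nat (𝕜 := ℝ)).const_mul 2)
    simpa using h2
  · intro k j hj i hi
    have hI : ∀ i, Integrable (fun x => homog (f i x)) μ := fun i =>
      integrable_homog (hint _ (hsub i (hfS i)))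
    have hmidS := hmid k _ (hanti hi (hfS i)) _ (hanti hj (hfS j))
    have h1 := hmle k _ hmidS
    have h2 : Φ (fun x => (1 / 2 : ℝ) • (f i x + f j x))
        = (1 / 2) * ∫ x, ‖homog (f i x) + homog (f j x)‖ ∂μ := by
      simp only [hΦ, homog_midpoint, norm_smul]
      rw [integral_const_mul]
      norm_num
    have h3 : ∫ x, (‖homog (f i x)‖ + ‖homog (f j x)‖ - ‖homog (f i x) + homog (f j x)‖) ∂μ
        = Φ (f i) + Φ (f j) - ∫ x, ‖homog (f i x) + homog (f j x)‖ ∂μ :=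
      (integral_sub ((hI i).norm.add (hI j).norm) ((hI i).add (hI j)).norm).trans
        (congrArg (· - _) (integral_add (hI i).norm (hI j).norm))
    have h4 : ∀ i, m i ≤ M := fun i => le_ciSup hbda i
    have h5 : ∀ i, k ≤ i → 1 / ((i : ℝ) + 1) ≤ 1 / ((k : ℝ) + 1) := fun i hi =>
      Nat.one_div_le_one_div hi
    rw [h3]
    linarith [hfm i, hfm j, h4 i, h4 j, h5 i hi, h5 j hj]

/-- Let `S k` be a decreasing sequence of nonempty midpoint-convex sets of functions that are
bounded in `L¹`. Then there are `f k ∈ S k` that converge almost everywhere. -/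
theorem exists_seq_mem_tendsto_ae [CompleteSpace H] (S : ℕ → Set (α → H)) (hanti : Antitone S)
    (hne : ∀ k, (S k).Nonempty)
    (hmid : ∀ k, ∀ f ∈ S k, ∀ g ∈ S k, (fun x => (1 / 2 : ℝ) • (f x + g x)) ∈ S k)
    (hint : ∀ f ∈ S 0, Integrable f μ) (C : ℝ) (hC : ∀ f ∈ S 0, ∫ x, ‖f x‖ ∂μ ≤ C) :
    ∃ (f : ℕ → α → H) (g : α → H), (∀ k, f k ∈ S k) ∧ StronglyMeasurable g ∧
      ∀ᵐ x ∂μ, Tendsto (fun k => f k x) atTop (𝓝 (g x)) := by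
  obtain ⟨f₀, ε, hf₀, hε, hdef⟩ := exists_near_minimizers (μ := μ) S hanti hne hmid hint C hC
  -- The squared L² distances of directions are to be below 4^(-n), so that the distances are below
  -- the summable 2^(-n).
  have hev : ∀ n : ℕ, ∀ᶠ k in atTop, 4 * ε k < ((1 / 4 : ℝ) ^ n) := fun n => by
    have := hε.const_mul 4
    rw [mul_zero] at this
    exact this.eventually_lt_const (by positivity)
  obtain ⟨φ, hφ, hφε⟩ := extraction_forall_of_eventually hev
  set f : ℕ → α → H := fun k => f₀ (φ k) with hf
  have hfS : ∀ k, f k ∈ S k := fun k => hanti (hφ.id_le k) (hf₀ _)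
  have hfI : ∀ k, Integrable (f k) μ := fun k => hint _ (hanti (Nat.zero_le k) (hfS k))
  have hI : ∀ k, Integrable (fun x => homog (f k x)) μ := fun k => integrable_homog (hfI k)
  -- Only the directions of (1, f) are controlled. They determine f, as the quotient of the second
  -- component by the first.
  set u : ℕ → α → WithLp 2 (ℝ × H) := fun k x => ‖homog (f k x)‖⁻¹ • homog (f k x) with hu
  have hum : ∀ k, AEStronglyMeasurable (u k) μ := fun k =>
    (hI k).1.norm.inv₀.smul (hI k).1
  have hu1 : ∀ k x, ‖u k x‖ = 1 := fun k x => by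
    have := one_le_norm_homog (f k x)
    simp only [hu, norm_smul, norm_inv, norm_norm]
    exact inv_mul_cancel₀ (by positivity)
  have huL : ∀ k, MemLp (u k) 2 μ := fun k =>
    MemLp.of_bound (hum k) 1 (Eventually.of_forall fun x => (hu1 k x).le)
  have hcau : ∀ K i j : ℕ, K ≤ i → K ≤ j →
      eLpNorm (u i - u j) 2 μ < ENNReal.ofReal ((1 / 2 : ℝ) ^ K) := by
    intro K i j hi hj
    rw [((huL i).sub (huL j)).eLpNorm_eq_integral_rpow_norm (by simp) (by simp)]
    rw [ENNReal.ofReal_lt_ofReal_iff (by positivity)]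
    have h1 : ∫ x, ‖(u i - u j) x‖ ^ (2 : ℝ) ∂μ < (1 / 4 : ℝ) ^ K := by
      calc ∫ x, ‖(u i - u j) x‖ ^ (2 : ℝ) ∂μ
          ≤ ∫ x, 4 * (‖homog (f i x)‖ + ‖homog (f j x)‖
              - ‖homog (f i x) + homog (f j x)‖) ∂μ := by
            refine integral_mono_of_nonneg (Eventually.of_forall fun x => by positivity) ?_ ?_
            · exact (((hI i).norm.add (hI j).norm).sub ((hI i).add (hI j)).norm).const_mul 4
            · refine Eventually.of_forall fun x => ?_
              simp only [Real.rpow_two, Pi.sub_apply]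
              exact norm_normalize_sub_sq_le _ _ (one_le_norm_homog _) (one_le_norm_homog _)
        _ = 4 * ∫ x, (‖homog (f i x)‖ + ‖homog (f j x)‖
              - ‖homog (f i x) + homog (f j x)‖) ∂μ := integral_const_mul _ _
        _ ≤ 4 * ε (φ K) := by
            have := hdef (φ K) (φ j) (hφ.monotone hj) (φ i) (hφ.monotone hi)
            simp only [hf]
            linarith
        _ < _ := hφε K
    have h0 : 0 ≤ ∫ x, ‖(u i - u j) x‖ ^ (2 : ℝ) ∂μ := integral_nonneg fun x => by positivity
    simp only [ENNReal.toReal_ofNat]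
    rw [show (2 : ℝ)⁻¹ = 1 / 2 by norm_num, ← Real.sqrt_eq_rpow,
      Real.sqrt_lt' (by positivity), ← pow_mul, mul_comm, pow_mul]
    norm_num at h1 ⊢
    exact h1
  have hsum : ∑' i : ℕ, ENNReal.ofReal ((1 / 2 : ℝ) ^ i) ≠ ⊤ := by
    rw [← ENNReal.ofReal_tsum_of_nonneg (fun i => by positivity)
      (summable_geometric_of_lt_one (by norm_num) (by norm_num))]
    exact ENNReal.ofReal_ne_top
  have hconv := Lp.ae_tendsto_of_cauchy_eLpNorm hum (by norm_num) hsum hcau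
  -- Fatou and the L¹ bound exclude divergence to infinity almost everywhere, so the limiting
  -- direction has nonzero first component.
  have hfat : ∫⁻ x, liminf (fun k => ‖homog (f k x)‖ₑ) atTop ∂μ
      ≤ ENNReal.ofReal (μ.real univ + C) := by
    refine (lintegral_liminf_le' fun k => (hI k).1.enorm).trans ?_
    refine liminf_le_of_frequently_le' (Eventually.frequently (Eventually.of_forall fun k => ?_))
    rw [← ofReal_integral_norm_eq_lintegral_enorm (hI k)]
    apply ENNReal.ofReal_le_ofReal
    have hk : f k ∈ S 0 := hanti (Nat.zero_le k) (hfS k)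
    calc ∫ x, ‖homog (f k x)‖ ∂μ ≤ ∫ x, (1 + ‖f k x‖) ∂μ :=
          integral_mono (hI k).norm ((integrable_const _).add (hfI k).norm)
            fun x => norm_homog_le _
      _ = μ.real univ + ∫ x, ‖f k x‖ ∂μ := by
          rw [integral_add (integrable_const _) (hfI k).norm]; simp
      _ ≤ _ := by linarith [hC _ hk]
  have hfin : ∀ᵐ x ∂μ, liminf (fun k => ‖homog (f k x)‖ₑ) atTop < ⊤ := by
    have hm := fun k => (hI k).1.enorm
    refine ae_lt_top' ⟨_, Measurable.liminf fun k => (hm k).measurable_mk, ?_⟩ ?_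
    · filter_upwards [ae_all_iff.2 fun k => (hm k).ae_eq_mk] with x hx
      simp only [hx]
    · exact (hfat.trans_lt ENNReal.ofReal_lt_top).ne
  have hex : ∀ᵐ x ∂μ, ∃ l, Tendsto (fun k => f k x) atTop (𝓝 l) := by
    filter_upwards [hconv, hfin] with x hx hxf
    obtain ⟨l, hl⟩ := hx
    have hfst : Tendsto (fun k => ‖homog (f k x)‖⁻¹) atTop (𝓝 l.fst) := by
      have : Tendsto (fun k => (u k x).fst) atTop (𝓝 l.fst) :=
        ((WithLp.continuous_fst 2 ℝ H).tendsto l).comp hl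
      simpa [hu, homog] using this
    have hsnd : Tendsto (fun k => ‖homog (f k x)‖⁻¹ • f k x) atTop (𝓝 l.snd) := by
      have : Tendsto (fun k => (u k x).snd) atTop (𝓝 l.snd) :=
        ((WithLp.continuous_snd 2 ℝ H).tendsto l).comp hl
      simpa [hu, homog] using this
    have hl0 : l.fst ≠ 0 := by
      intro h0
      rw [h0] at hfst
      have h1 : Tendsto (fun k => ‖homog (f k x)‖) atTop atTop := by
        have := Tendsto.inv_tendsto_nhdsGT_zero (f := fun k => ‖homog (f k x)‖⁻¹)
          (tendsto_nhdsWithin_iff.2 ⟨hfst, Eventually.of_forall fun k => by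
            have := one_le_norm_homog (f k x)
            simp only [mem_Ioi]; positivity⟩)
        exact this.congr fun k => inv_inv _
      have h2 : Tendsto (fun k => ‖homog (f k x)‖ₑ) atTop (𝓝 ⊤) := by
        simp_rw [← ofReal_norm]
        exact ENNReal.tendsto_ofReal_nhds_top.2 h1
      rw [h2.liminf_eq] at hxf
      exact lt_irrefl _ hxf
    refine ⟨l.fst⁻¹ • l.snd, ?_⟩
    have := (hfst.inv₀ hl0).smul hsnd
    refine this.congr fun k => ?_
    have := one_le_norm_homog (f k x)
    rw [inv_inv, smul_smul, mul_inv_cancel₀ (by positivity), one_smul]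
  obtain ⟨g, hg, hgl⟩ := exists_stronglyMeasurable_limit_of_tendsto_ae (fun k => (hfI k).1) hex
  exact ⟨f, g, hfS, hg, hgl⟩

end Selection

/-! ### Even convex functions and their Legendre transforms -/

/-- Convex even nonnegative functions that vanish at the origin. -/
structure IsEvenConvex {n : ℕ} (K : Vec n → ℝ) : Prop where
  nonneg : ∀ y, 0 ≤ K y
  convex : ConvexOn ℝ univ K
  even : ∀ y, K (-y) = K y
  map_zero : K 0 = 0

section EvenConvex

variable {n : ℕ} {K : Vec n → ℝ}

lemma IsNFunction.isEvenConvex (hK : IsNFunction K) : IsEvenConvex K := by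
  refine ⟨hK.nonneg, hK.convex, hK.even, ?_⟩
  obtain ⟨Φ₁, Φ₂, -, h₂, h⟩ := hK.between
  have := (h 0).2
  rw [norm_zero, (h₂.eq_zero_iff 0).2 rfl] at this
  exact le_antisymm this (hK.nonneg 0)

namespace IsEvenConvex

lemma continuous (hK : IsEvenConvex K) : Continuous K := by
  rw [← continuousOn_univ]
  exact hK.convex.continuousOn isOpen_univ

lemma smul_le (hK : IsEvenConvex K) {r : ℝ} (h0 : 0 ≤ r) (h1 : r ≤ 1) (y : Vec n) :
    K (r • y) ≤ r * K y := by
  have := hK.convex.2 (mem_univ y) (mem_univ (0 : Vec n)) h0 (sub_nonneg.2 h1) (by ring)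
  simpa [hK.map_zero] using this

lemma map_abs_smul (hK : IsEvenConvex K) (r : ℝ) (y : Vec n) : K (|r| • y) = K (r • y) := by
  rcases abs_choice r with h | h
  · rw [h]
  · rw [h, neg_smul, hK.even]

lemma smul_mono (hK : IsEvenConvex K) {r R : ℝ} (h : |r| ≤ R) (y : Vec n) :
    K (r • y) ≤ K (R • y) := by
  rcases (abs_nonneg r).trans h |>.eq_or_lt with h0 | h0
  · have : r = 0 := by rw [← h0] at h; exact abs_nonpos_iff.1 h
    rw [this, ← h0]
  · have h1 := hK.smul_le (div_nonneg (abs_nonneg r) h0.le) ((div_le_one h0).2 h) (R • y)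
    rw [smul_smul, div_mul_cancel₀ _ h0.ne', hK.map_abs_smul] at h1
    refine h1.trans (mul_le_of_le_one_left (hK.nonneg _) ((div_le_one h0).2 h))

lemma midpoint_le (hK : IsEvenConvex K) (y z : Vec n) :
    K ((1 / 2 : ℝ) • (y + z)) ≤ 1 / 2 * (K y + K z) := by
  have := hK.convex.2 (mem_univ y) (mem_univ z) (show (0 : ℝ) ≤ 1 / 2 by norm_num)
    (show (0 : ℝ) ≤ 1 / 2 by norm_num) (by norm_num)
  rw [smul_add]
  simpa [mul_add] using this

/-- Convexity at the midpoint of 2y and -2z. -/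
lemma sub_le (hK : IsEvenConvex K) (y z : Vec n) :
    K (y - z) ≤ 1 / 2 * (K ((2 : ℝ) • y) + K ((2 : ℝ) • z)) := by
  have := hK.midpoint_le ((2 : ℝ) • y) (-((2 : ℝ) • z))
  rw [hK.even] at this
  convert this using 2
  rw [← smul_neg, ← smul_add, smul_smul, ← sub_eq_add_neg]
  norm_num

/-- The Δ₂-condition is iterated j times with 2^j > R; smaller factors follow because K is
nondecreasing along rays. -/
lemma exists_smul_le (hK : IsEvenConvex K) (h2 : Delta2 K) (R : ℝ) :
    ∃ C, 0 ≤ C ∧ ∀ (y : Vec n) (r : ℝ), |r| ≤ R → K (r • y) ≤ C * (K y + 1) := by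
  obtain ⟨C, hC⟩ := h2
  have hC' : ∀ y, K ((2 : ℝ) • y) ≤ max C 1 * (K y + 1) := fun y =>
    (hC y).trans (mul_le_mul_of_nonneg_right (le_max_left _ _) (by linarith [hK.nonneg y]))
  have hD : (1 : ℝ) ≤ max C 1 := le_max_right _ _
  generalize max C 1 = D at hC' hD
  have hpow : ∀ j : ℕ, ∃ A, 0 ≤ A ∧ ∀ y, K ((2 : ℝ) ^ j • y) ≤ A * (K y + 1) := by
    intro j
    induction j with
    | zero => exact ⟨1, zero_le_one, fun y => by simp⟩
    | succ j ih =>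
      obtain ⟨A, hA, h⟩ := ih
      refine ⟨D * (A + 1), by positivity, fun y => ?_⟩
      rw [pow_succ', mul_smul]
      calc K ((2 : ℝ) • (2 : ℝ) ^ j • y) ≤ D * (K ((2 : ℝ) ^ j • y) + 1) := hC' _
        _ ≤ D * (A * (K y + 1) + 1) := by gcongr; exact h y
        _ ≤ D * (A + 1) * (K y + 1) := by nlinarith [hK.nonneg y]
  obtain ⟨j, hj⟩ := pow_unbounded_of_one_lt R (one_lt_two : (1 : ℝ) < 2)
  obtain ⟨A, hA, h⟩ := hpow j
  exact ⟨A, hA, fun y r hr => (hK.smul_mono (hr.trans hj.le) y).trans (h y)⟩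

end IsEvenConvex

/-! ### Orlicz classes -/

section Orlicz

variable {Q : Type*} [MeasurableSpace Q] {μ : Measure Q} {f g : Q → Vec n}

lemma MemOrlicz.mono (hK : IsEvenConvex K) {G : Q → ℝ} (hf : AEStronglyMeasurable f μ)
    (hG : Integrable G μ) (h : ∀ᵐ q ∂μ, K (f q) ≤ G q) : MemOrlicz K f μ :=
  ⟨hf, hG.mono' (hK.continuous.comp_aestronglyMeasurable hf) (h.mono fun q hq => by
    rwa [Real.norm_of_nonneg (hK.nonneg _)])⟩

lemma MemOrlicz.midpoint (hK : IsEvenConvex K) (hf : MemOrlicz K f μ) (hg : MemOrlicz K g μ) :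
    MemOrlicz K (fun q => (1 / 2 : ℝ) • (f q + g q)) μ :=
  .mono hK ((hf.1.add hg.1).const_smul (1 / 2 : ℝ)) ((hf.2.add hg.2).const_mul (1 / 2))
    (Eventually.of_forall fun _ => hK.midpoint_le _ _)

variable [IsFiniteMeasure μ]

lemma MemOrlicz.smul (hK : IsEvenConvex K) (h2 : Delta2 K) (hf : MemOrlicz K f μ) {h : Q → ℝ}
    (hh : AEStronglyMeasurable h μ) {R : ℝ} (hR : ∀ᵐ q ∂μ, |h q| ≤ R) :
    MemOrlicz K (fun q => h q • f q) μ := by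
  obtain ⟨C, -, hC⟩ := hK.exists_smul_le h2 R
  exact .mono hK (hh.smul hf.1) ((hf.2.add (integrable_const 1)).const_mul C)
    (hR.mono fun q hq => hC _ _ hq)

lemma MemOrlicz.const_smul (hK : IsEvenConvex K) (h2 : Delta2 K) (hf : MemOrlicz K f μ) (r : ℝ) :
    MemOrlicz K (fun q => r • f q) μ :=
  hf.smul hK h2 aestronglyMeasurable_const (Eventually.of_forall fun _ => le_refl |r|)

lemma MemOrlicz.sub (hK : IsEvenConvex K) (h2 : Delta2 K) (hf : MemOrlicz K f μ)
    (hg : MemOrlicz K g μ) : MemOrlicz K (fun q => f q - g q) μ :=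
  .mono hK (hf.1.sub hg.1)
    (((hf.const_smul hK h2 2).2.add (hg.const_smul hK h2 2).2).const_mul (1 / 2))
    (Eventually.of_forall fun _ => hK.sub_le _ _)

lemma MemOrlicz.of_bound (hK : IsEvenConvex K) (hf : AEStronglyMeasurable f μ) {R : ℝ}
    (hR : ∀ᵐ q ∂μ, ‖f q‖ ≤ R) : MemOrlicz K f μ := by
  obtain ⟨C, hC⟩ := (isCompact_closedBall (0 : Vec n) R).exists_bound_of_continuousOn
    hK.continuous.continuousOn
  refine .mono hK hf (integrable_const C) (hR.mono fun q hq => ?_)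
  exact (le_abs_self _).trans (hC _ (by simpa using hq))

end Orlicz

/-! ### The Legendre transform of an `N`-function -/

namespace IsNFunction

/-- By superlinear growth, K(v) ≥ |v||y| once |v| is large, so the supremum only sees a bounded set
of v. -/
lemma bddAbove_conj (hK : IsNFunction K) (y : Vec n) :
    BddAbove (range fun v : Vec n => inner ℝ v y - K v) := by
  obtain ⟨Φ₁, Φ₂, h₁, -, h⟩ := hK.between
  obtain ⟨s₀, hs₀⟩ := eventually_atTop.1 ((tendsto_atTop.1 h₁.lim_top) ‖y‖)
  refine ⟨max s₀ 1 * ‖y‖, ?_⟩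
  rintro _ ⟨v, rfl⟩
  have h3 := real_inner_le_norm v y
  have h4 := (h v).1
  rcases le_total ‖v‖ (max s₀ 1) with hv | hv
  · have := mul_le_mul_of_nonneg_right hv (norm_nonneg y)
    linarith [hK.nonneg v]
  · have hv0 : 0 < ‖v‖ := lt_of_lt_of_le (by positivity) hv
    have h5 := hs₀ ‖v‖ ((le_max_left _ _).trans hv)
    rw [le_div_iff₀ hv0] at h5
    have : 0 ≤ max s₀ 1 * ‖y‖ := by positivity
    show inner ℝ v y - K v ≤ _
    nlinarith

/-- The Fenchel–Young inequality. -/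
lemma inner_le (hK : IsNFunction K) (v y : Vec n) : inner ℝ v y ≤ K v + conj K y := by
  have := le_ciSup (hK.bddAbove_conj y) v
  simp only [conj]
  linarith

lemma abs_inner_le (hK : IsNFunction K) (v y : Vec n) : |inner ℝ v y| ≤ K v + conj K y := by
  refine abs_le'.2 ⟨hK.inner_le v y, ?_⟩
  have := hK.inner_le (-v) y
  rwa [inner_neg_left, hK.even] at this

lemma isEvenConvex_conj (hK : IsNFunction K) : IsEvenConvex (conj K) := by
  have h0 := hK.isEvenConvex.map_zero
  have hn : ∀ y, 0 ≤ conj K y := fun y => by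
    have := hK.inner_le 0 y
    simpa [h0] using this
  refine ⟨hn, ⟨convex_univ, fun x _ y _ a b ha hb hab => ?_⟩, fun y => ?_, ?_⟩
  · refine ciSup_le fun v => ?_
    have h1 := mul_le_mul_of_nonneg_left (hK.inner_le v x) ha
    have h2 := mul_le_mul_of_nonneg_left (hK.inner_le v y) hb
    rw [inner_add_right, inner_smul_right, inner_smul_right]
    simp only [smul_eq_mul]
    have h3 : a * K v + b * K v = K v := by rw [← add_mul, hab, one_mul]
    linarith
  · simp only [conj]
    refine (Equiv.neg (Vec n)).iSup_congr fun v => ?_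
    simp [hK.even]
  · refine le_antisymm (ciSup_le fun v => ?_) (hn 0)
    simpa using hK.nonneg v

/-- Fenchel–Young at the unit vector y/|y|. This makes a bound on ∫ K*(E) a bound in L¹. -/
lemma exists_norm_le_conj (hK : IsNFunction K) : ∃ C, 0 ≤ C ∧ ∀ y, ‖y‖ ≤ conj K y + C := by
  obtain ⟨Φ₁, Φ₂, -, h₂, h⟩ := hK.between
  refine ⟨Φ₂ 1, h₂.nonneg 1, fun y => ?_⟩
  rcases eq_or_ne y 0 with rfl | hy
  · simpa using add_nonneg (hK.isEvenConvex_conj.nonneg 0) (h₂.nonneg 1)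
  · have hy' : ‖y‖ ≠ 0 := norm_ne_zero_iff.2 hy
    have h1 := hK.inner_le (‖y‖⁻¹ • y) y
    have h3 := (h (‖y‖⁻¹ • y)).2
    rw [norm_smul, norm_inv, norm_norm, inv_mul_cancel₀ hy'] at h3
    rw [real_inner_smul_left, real_inner_self_eq_norm_sq, pow_two,
      inv_mul_cancel_left₀ hy'] at h1
    linarith

/-- Measurable selections of approximate maximizers in the definition of the Legendre transform. -/
lemma exists_selection (hK : IsNFunction K) : ∃ U : ℕ → Vec n → Vec n,
    (∀ m, Measurable (U m)) ∧ (∀ m, ∃ R, ∀ y, ‖U m y‖ ≤ R) ∧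
    (∀ m y, 0 ≤ inner ℝ (U m y) y - K (U m y)) ∧
    ∀ y, Tendsto (fun m => inner ℝ (U m y) y - K (U m y)) atTop (𝓝 (conj K y)) := by
  have hKc := hK.isEvenConvex.continuous
  set q := TopologicalSpace.denseSeq (Vec n)
  -- A running maximizer over a dense sequence, started at 0: it takes finitely many values at each
  -- stage, and the values it achieves are nonnegative and increasing.
  set U : ℕ → Vec n → Vec n := fun m => Nat.rec (fun _ => 0) (fun m u y =>
    if inner ℝ (u y) y - K (u y) ≤ inner ℝ (q m) y - K (q m) then q m else u y) m
  have hU0 : ∀ y, U 0 y = 0 := fun y => rfl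
  have hUs : ∀ m y, U (m + 1) y = if inner ℝ (U m y) y - K (U m y) ≤ inner ℝ (q m) y - K (q m)
    then q m else U m y := fun m y => rfl
  have hmax : ∀ m y, inner ℝ (U m y) y - K (U m y)
      ≤ inner ℝ (U (m + 1) y) y - K (U (m + 1) y) ∧
      inner ℝ (q m) y - K (q m) ≤ inner ℝ (U (m + 1) y) y - K (U (m + 1) y) := by
    intro m y
    rw [hUs]
    split_ifs with h
    · exact ⟨h, le_rfl⟩
    · exact ⟨le_rfl, (not_le.1 h).le⟩
  have hmono : ∀ y, Monotone fun m => inner ℝ (U m y) y - K (U m y) := fun y =>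
    monotone_nat_of_le_succ fun m => (hmax m y).1
  refine ⟨U, fun m => ?_, fun m => ?_, fun m y => ?_, fun y => ?_⟩
  · induction m with
    | zero => exact measurable_const
    | succ m ih =>
      refine Measurable.ite (measurableSet_le ?_ ?_) measurable_const ih
      · exact (ih.inner measurable_id).sub (hKc.measurable.comp ih)
      · exact (measurable_const.inner measurable_id).sub measurable_const
  · induction m with
    | zero => exact ⟨0, fun y => by simp [hU0]⟩
    | succ m ih =>
      obtain ⟨R, hR⟩ := ih
      refine ⟨max R ‖q m‖, fun y => ?_⟩
      rw [hUs]
      split_ifs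
      · exact le_max_right _ _
      · exact (hR y).trans (le_max_left _ _)
  · have := hmono y (Nat.zero_le m)
    simpa [hU0, hK.isEvenConvex.map_zero] using this
  · refine tendsto_atTop_isLUB (hmono y) ⟨?_, fun b hb => ?_⟩
    · rintro _ ⟨m, rfl⟩
      exact le_ciSup (hK.bddAbove_conj y) (U m y)
    · refine ciSup_le fun v => ?_
      have hcl : IsClosed {v : Vec n | inner ℝ v y - K v ≤ b} :=
        isClosed_le (by fun_prop) continuous_const
      have hsub : range q ⊆ {v : Vec n | inner ℝ v y - K v ≤ b} := by
        rintro _ ⟨m, rfl⟩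
        exact (hmax m y).2.trans (hb ⟨m + 1, rfl⟩)
      exact hcl.closure_subset_iff.2 hsub (TopologicalSpace.denseRange_denseSeq (Vec n) v)

variable {Q : Type*} [MeasurableSpace Q] {μ : Measure Q}

lemma integrable_inner (hK : IsNFunction K) {z E : Q → Vec n} (hz : MemOrlicz K z μ)
    (hE : MemOrlicz (conj K) E μ) : Integrable (fun q => inner ℝ (z q) (E q)) μ :=
  (hz.2.add hE.2).mono' (hz.1.inner hE.1) (Eventually.of_forall fun _ => hK.abs_inner_le _ _)

/-- The duality pairing with a fixed element of `L_K` is continuous along almost everywhere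
convergent sequences that are bounded in `L_{K*}`. -/
lemma tendsto_integral_inner [IsFiniteMeasure μ] (hK : IsNFunction K) (h2 : Delta2 K)
    {z : Q → Vec n} (hz : MemOrlicz K z μ) {E : ℕ → Q → Vec n} {E' : Q → Vec n}
    (hE : ∀ k, MemOrlicz (conj K) (E k) μ) (hE' : MemOrlicz (conj K) E' μ) (C : ℝ)
    (hC : ∀ k, ∫ q, conj K (E k q) ∂μ ≤ C)
    (hlim : ∀ᵐ q ∂μ, Tendsto (fun k => E k q) atTop (𝓝 (E' q))) :
    Tendsto (fun k => ∫ q, inner ℝ (z q) (E k q) ∂μ) atTop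
      (𝓝 (∫ q, inner ℝ (z q) (E' q) ∂μ)) := by
  have hKe := hK.isEvenConvex
  have hKs := hK.isEvenConvex_conj
  -- By convexity and evenness `e k` dominates K*((E k - E')/2), and its integral is bounded
  -- uniformly in k.
  set e : ℕ → Q → ℝ := fun k q => 1 / 2 * (conj K (E k q) + conj K (E' q)) with he
  have heI : ∀ k, Integrable (e k) μ := fun k => ((hE k).2.add hE'.2).const_mul _
  have he0 : ∀ k q, 0 ≤ e k q := fun k q =>
    mul_nonneg (one_half_pos (α := ℝ)).le (add_nonneg (hKs.nonneg (E k q)) (hKs.nonneg (E' q)))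
  set D := 1 / 2 * (C + ∫ q, conj K (E' q) ∂μ) with hD
  have heD : ∀ k, ∫ q, e k q ∂μ ≤ D := by
    intro k
    rw [he, integral_const_mul, integral_add (hE k).2 hE'.2]
    have := hC k
    linarith
  have hdiff : ∀ k, ∫ q, inner ℝ (z q) (E k q) ∂μ - ∫ q, inner ℝ (z q) (E' q) ∂μ
      = ∫ q, inner ℝ (z q) (E k q - E' q) ∂μ := by
    intro k
    rw [← integral_sub (hK.integrable_inner hz (hE k)) (hK.integrable_inner hz hE')]
    simp_rw [inner_sub_right]
  have hI : ∀ k, Integrable (fun q => inner ℝ (z q) (E k q - E' q)) μ := fun k => by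
    simp_rw [inner_sub_right]
    exact (hK.integrable_inner hz (hE k)).sub (hK.integrable_inner hz hE')
  -- Fenchel–Young with the factor 2λ moved onto z: the term in E, which is only bounded in mean,
  -- becomes small like 1/λ.
  have hyoung : ∀ lam : ℝ, 1 ≤ lam → ∀ k q,
      |inner ℝ (z q) (E k q - E' q)| ≤ K ((2 * lam) • z q) + e k q / lam := by
    intro lam hlam k q
    have hlam0 : (0 : ℝ) < lam := by linarith
    have h1 := hK.abs_inner_le ((2 * lam) • z q) (lam⁻¹ • (1 / 2 : ℝ) • (E k q + -E' q))
    have h3 : inner ℝ ((2 * lam) • z q) (lam⁻¹ • (1 / 2 : ℝ) • (E k q + -E' q))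
        = inner ℝ (z q) (E k q - E' q) := by
      rw [inner_smul_left, inner_smul_right, inner_smul_right, ← sub_eq_add_neg]
      simp only [conj_trivial]
      field_simp
    rw [h3] at h1
    refine h1.trans (add_le_add le_rfl ?_)
    refine (hKs.smul_le (by positivity) (inv_le_one_of_one_le₀ hlam) _).trans ?_
    rw [div_eq_inv_mul (e k q)]
    refine mul_le_mul_of_nonneg_left ?_ (inv_nonneg.2 hlam0.le)
    have := hKs.midpoint_le (E k q) (-E' q)
    rwa [hKs.even] at this
  rw [tendsto_iff_norm_sub_tendsto_zero]
  simp_rw [hdiff]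
  rw [Metric.tendsto_atTop]
  intro ε hε
  obtain ⟨m, hm⟩ := exists_nat_gt (2 * D / ε)
  set lam : ℝ := (m : ℝ) + 1 with hlam
  have hlam1 : 1 ≤ lam := by simp [hlam]
  have hlam0 : 0 < lam := by linarith
  have hDl : D / lam < ε / 2 := by
    rw [div_lt_iff₀ hε] at hm
    rw [div_lt_iff₀ hlam0, hlam]
    linarith
  -- The part of the pairing exceeding `e k / lam`. It is dominated by K(2λz), integrable by the
  -- Δ₂-condition, so dominated convergence applies to it.
  set r : ℕ → Q → ℝ := fun k q => max (|inner ℝ (z q) (E k q - E' q)| - e k q / lam) 0 with hr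
  have hrm : ∀ k, AEStronglyMeasurable (r k) μ := fun k =>
    ((hI k).1.norm.sub ((heI k).div_const lam).1).sup aestronglyMeasurable_const
  have hrb : ∀ k q, ‖r k q‖ ≤ K ((2 * lam) • z q) := by
    intro k q
    rw [Real.norm_of_nonneg (le_max_right _ _)]
    refine max_le ?_ (hKe.nonneg _)
    linarith [hyoung lam hlam1 k q]
  have hdom := (hz.const_smul hKe h2 (2 * lam)).2
  have hrt : Tendsto (fun k => ∫ q, r k q ∂μ) atTop (𝓝 (∫ _, (0 : ℝ) ∂μ)) := by
    refine tendsto_integral_of_dominated_convergence _ hrm hdom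
      (fun k => Eventually.of_forall (hrb k)) ?_
    filter_upwards [hlim] with q hq
    have h1 : Tendsto (fun k => |inner ℝ (z q) (E k q - E' q)|) atTop (𝓝 0) := by
      have h3 : Tendsto (fun k => E k q - E' q) atTop (𝓝 0) := by
        simpa using hq.sub_const (E' q)
      simpa using ((tendsto_const_nhds (x := z q)).inner (𝕜 := ℝ) h3).abs
    refine squeeze_zero (fun k => le_max_right _ _) (fun k => ?_) h1
    refine max_le ?_ (abs_nonneg _)
    linarith [div_nonneg (he0 k q) hlam0.le]
  rw [integral_zero] at hrt
  obtain ⟨k₀, hk₀⟩ := eventually_atTop.1 (hrt.eventually_lt_const (half_pos hε))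
  refine ⟨k₀, fun k hk => ?_⟩
  rw [Real.dist_eq, sub_zero, abs_norm]
  have hrI : Integrable (r k) μ :=
    hdom.mono' (hrm k) (Eventually.of_forall (hrb k))
  calc ‖∫ q, inner ℝ (z q) (E k q - E' q) ∂μ‖
      ≤ ∫ q, ‖inner ℝ (z q) (E k q - E' q)‖ ∂μ := norm_integral_le_integral_norm _
    _ ≤ ∫ q, (r k q + e k q / lam) ∂μ := by
        refine integral_mono (hI k).norm (hrI.add ((heI k).div_const _)) fun q => ?_
        have := le_max_left (|inner ℝ (z q) (E k q - E' q)| - e k q / lam) 0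
        simp only [hr, Real.norm_eq_abs]
        linarith
    _ = ∫ q, r k q ∂μ + (∫ q, e k q ∂μ) / lam := by
        rw [integral_add hrI ((heI k).div_const _), integral_div]
    _ ≤ ∫ q, r k q ∂μ + D / lam := by gcongr; exact heD k
    _ < ε := by linarith [hk₀ k hk]

end IsNFunction

end EvenConvex

/-! ### Smooth functions on the periodic box -/

section TorusCalculus

variable {d : ℕ} {ℓ : Fin d → ℝ}

/-- Openness matters: products of open quotient maps are again quotient maps, so continuity on ℝ × Ω
can be checked on the covering space. -/
lemma isOpenQuotientMap_proj : IsOpenQuotientMap (proj ℓ) :=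
  IsOpenQuotientMap.piMap fun _ => QuotientAddGroup.isOpenQuotientMap_mk

lemma proj_add_single (i : Fin d) (y : Fin d → ℝ) (s : ℝ) :
    proj ℓ (y + Pi.single i s) = proj ℓ y + Pi.single i (s : AddCircle (ℓ i)) := by
  ext j
  rcases eq_or_ne j i with rfl | h
  · simp [proj]
  · simp [proj, h]

/-- Functions on `ℝ × Ω` that are jointly smooth. -/
def JointSmooth (g : ℝ → Torus ℓ → ℝ) : Prop :=
  ContDiff ℝ ∞ (fun p : ℝ × (Fin d → ℝ) => g p.1 (proj ℓ p.2))

lemma Smooth.jointSmooth {f : Torus ℓ → ℝ} (hf : Smooth f) : JointSmooth fun _ => f :=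
  ContDiff.comp (g := fun y => f (proj ℓ y)) hf contDiff_snd

namespace JointSmooth

variable {g : ℝ → Torus ℓ → ℝ}

lemma continuous (hg : JointSmooth g) : Continuous fun p : ℝ × Torus ℓ => g p.1 p.2 :=
  ((IsOpenQuotientMap.id (X := ℝ)).prodMap (isOpenQuotientMap_proj (ℓ := ℓ))).continuous_comp_iff.1
    (ContDiff.continuous hg)

/-- On the covering space the derivative is a directional derivative of the lift, hence smooth with
all parameters. -/
lemma partialDeriv (hg : JointSmooth g) (i : Fin d) :
    JointSmooth fun t => partialDeriv i (g t) := by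
  set G : ℝ × (Fin d → ℝ) → ℝ := fun p => g p.1 (proj ℓ p.2)
  have hG : ContDiff ℝ ∞ G := hg
  have h1 : ContDiff ℝ ∞ fun p => fderiv ℝ G p (0, Pi.single i 1) :=
    (hG.fderiv_right (m := ∞) (by norm_num)).clm_apply contDiff_const
  have h2 : (fun p : ℝ × (Fin d → ℝ) => DualOrlicz.partialDeriv i (g p.1) (proj ℓ p.2))
      = fun p => fderiv ℝ G p (0, Pi.single i 1) := by
    funext p
    have h3 : HasDerivAt (fun s : ℝ => p + s • ((0 : ℝ), Pi.single i (1 : ℝ)))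
        ((0 : ℝ), Pi.single i (1 : ℝ)) 0 := by
      simpa using ((hasDerivAt_id (0 : ℝ)).smul_const
        ((0 : ℝ), (Pi.single i (1 : ℝ) : Fin d → ℝ))).const_add p
    have h4 : HasFDerivAt G (fderiv ℝ G p) (p + (0 : ℝ) • ((0 : ℝ), Pi.single i (1 : ℝ))) := by
      simpa using (hG.differentiable (by norm_num) p).hasFDerivAt
    have h5 := (h4.comp_hasDerivAt (0 : ℝ) h3).deriv
    rw [← h5]
    simp only [DualOrlicz.partialDeriv]
    congr 1
    funext s
    simp only [Function.comp, G]
    rw [← proj_add_single]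
    simp [← Pi.single_smul]
  simpa only [JointSmooth, h2] using h1

lemma iterate_partialDeriv (hg : JointSmooth g) (i : Fin d) (k : ℕ) :
    JointSmooth fun t => (DualOrlicz.partialDeriv i)^[k] (g t) := by
  induction k with
  | zero => exact hg
  | succ k ih =>
    simp only [Function.iterate_succ_apply']
    exact ih.partialDeriv i

lemma multiDeriv (hg : JointSmooth g) (α : Fin d → ℕ) :
    JointSmooth fun t => multiDeriv α (g t) := by
  unfold DualOrlicz.multiDeriv
  induction List.finRange d with
  | nil => exact hg
  | cons i l ih => exact ih.iterate_partialDeriv i (α i)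

lemma deriv_time (hg : JointSmooth g) : JointSmooth fun t x => deriv (fun s => g s x) t := by
  set G : ℝ × (Fin d → ℝ) → ℝ := fun p => g p.1 (proj ℓ p.2)
  have hG : ContDiff ℝ ∞ G := hg
  have h1 : ContDiff ℝ ∞ fun p => fderiv ℝ G p (1, 0) :=
    (hG.fderiv_right (m := ∞) (by norm_num)).clm_apply contDiff_const
  have h2 : (fun p : ℝ × (Fin d → ℝ) => deriv (fun s => g s (proj ℓ p.2)) p.1)
      = fun p => fderiv ℝ G p (1, 0) := by
    funext p
    have h3 : HasDerivAt (fun s : ℝ => (s, p.2)) ((1 : ℝ), (0 : Fin d → ℝ)) p.1 :=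
      (hasDerivAt_id _).prodMk (hasDerivAt_const _ _)
    have h4 : HasFDerivAt G (fderiv ℝ G p) (p.1, p.2) :=
      (hG.differentiable (by norm_num) p).hasFDerivAt
    exact (h4.comp_hasDerivAt p.1 h3).deriv
  simpa only [JointSmooth, h2] using h1

end JointSmooth

lemma partialDeriv_const_mul (i : Fin d) (c : ℝ) (f : Torus ℓ → ℝ) :
    partialDeriv i (fun y => c * f y) = fun y => c * partialDeriv i f y := by
  funext x
  simp only [partialDeriv, deriv_const_mul_field]

lemma multiDeriv_const_mul (α : Fin d → ℕ) (c : ℝ) (f : Torus ℓ → ℝ) :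
    multiDeriv α (fun y => c * f y) = fun y => c * multiDeriv α f y := by
  have hit : ∀ (i : Fin d) (k : ℕ) (f : Torus ℓ → ℝ), (partialDeriv i)^[k] (fun y => c * f y)
      = fun y => c * (partialDeriv i)^[k] f y := by
    intro i k
    induction k with
    | zero => intro f; rfl
    | succ k ih =>
      intro f
      rw [Function.iterate_succ_apply, partialDeriv_const_mul, ih, Function.iterate_succ_apply]
  unfold multiDeriv
  induction List.finRange d with
  | nil => rfl
  | cons i l ih => simp only [List.foldr_cons, ih, hit]

variable {n N : ℕ} (L : DiffOp d n N)

lemma DiffOp.apply_smul (c : ℝ) (Ξ : Torus ℓ → Mat N) (x : Torus ℓ) :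
    L.apply (fun y => c • Ξ y) x = c • L.apply Ξ x := by
  ext i
  simp only [DiffOp.apply, Matrix.smul_apply, smul_eq_mul, multiDeriv_const_mul, PiLp.smul_apply,
    Finset.mul_sum]
  refine Finset.sum_congr rfl fun j _ => Finset.sum_congr rfl fun l _ =>
    Finset.sum_congr rfl fun m _ => Finset.sum_congr rfl fun α _ => by ring

lemma DiffOp.continuous_apply {Ψ : ℝ → Torus ℓ → Mat N}
    (hΨ : ∀ l m, JointSmooth fun t x => Ψ t x l m) :
    Continuous fun p : ℝ × Torus ℓ => L.apply (Ψ p.1) p.2 := by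
  refine (PiLp.continuous_toLp 2 _).comp (continuous_pi fun i => ?_)
  refine continuous_finsetSum _ fun j _ => continuous_finsetSum _ fun l _ =>
    continuous_finsetSum _ fun m _ => continuous_finsetSum _ fun α _ => ?_
  exact continuous_const.mul ((hΨ l m).multiDeriv α).continuous

lemma DiffOp.continuous_apply_space {Ψ : Torus ℓ → Mat N}
    (hΨ : ∀ l m, Smooth fun x => Ψ x l m) : Continuous (L.apply Ψ) := by
  have h := L.continuous_apply (Ψ := fun _ => Ψ) fun l m => (hΨ l m).jointSmooth
  have h0 : Continuous fun x : Torus ℓ => ((0 : ℝ), x) := by fun_prop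
  have h1 := Continuous.comp (g := fun p : ℝ × Torus ℓ => L.apply Ψ p.2) h h0
  exact h1

lemma IsTestField.continuous_timeDeriv {Ψ : ℝ → Torus ℓ → Mat N} (hΨ : IsTestField Ψ)
    (l m : Fin N) : Continuous fun p : ℝ × Torus ℓ => timeDeriv Ψ p.1 p.2 l m :=
  (JointSmooth.deriv_time (g := fun t x => Ψ t x l m) (hΨ.smooth l m)).continuous

lemma isTestField_mul {h : ℝ → ℝ} (hh : ContDiff ℝ ∞ h) (h0 : h 0 = 0) {Ψ : Torus ℓ → Mat N}
    (hs : ∀ x, (Ψ x).IsSymm) (hΨ : ∀ l m, Smooth fun x => Ψ x l m) :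
    IsTestField fun t x => h t • Ψ x where
  symm t x := (hs x).smul _
  smooth l m := (hh.comp contDiff_fst).mul (hΨ l m).jointSmooth
  initial x := by simp [h0]

lemma timeDeriv_mul {h η : ℝ → ℝ} (hh : ∀ t, HasDerivAt h (η t) t) (Ψ : Torus ℓ → Mat N) (t : ℝ)
    (x : Torus ℓ) : timeDeriv (fun t x => h t • Ψ x) t x = η t • Ψ x := by
  ext l m
  simpa [timeDeriv] using ((hh t).mul_const (Ψ x l m)).deriv

end TorusCalculus

/-! ### The space-time measure and bounds by compactness -/

section SpaceTime

variable {d : ℕ} {ℓ : Fin d → ℝ} [∀ i, Fact (0 < ℓ i)] {T : ℝ}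

instance : IsFiniteMeasure (spaceTime ℓ T) := by unfold spaceTime; infer_instance

lemma ae_spaceTime_mem : ∀ᵐ p ∂(spaceTime ℓ T), p.1 ∈ Ioo 0 T := by
  have : ∀ᵐ t ∂(volume.restrict (Ioo 0 T) : Measure ℝ), t ∈ Ioo 0 T :=
    ae_restrict_mem measurableSet_Ioo
  exact Measure.quasiMeasurePreserving_fst.ae this

lemma exists_bound_spaceTime {X : Type*} [SeminormedAddCommGroup X] {g : ℝ × Torus ℓ → X}
    (hg : Continuous g) : ∃ C, ∀ᵐ p ∂(spaceTime ℓ T), ‖g p‖ ≤ C := by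
  obtain ⟨C, hC⟩ := ((isCompact_Icc (a := (0 : ℝ)) (b := T)).prod
    (isCompact_univ (X := Torus ℓ))).exists_bound_of_continuousOn hg.continuousOn
  exact ⟨C, ae_spaceTime_mem.mono fun p hp => hC p ⟨Ioo_subset_Icc_self hp, mem_univ _⟩⟩

lemma exists_bound_torus {X : Type*} [SeminormedAddCommGroup X] {g : Torus ℓ → X}
    (hg : Continuous g) : ∃ C, ∀ x, ‖g x‖ ≤ C := by
  obtain ⟨C, hC⟩ := (isCompact_univ (X := Torus ℓ)).exists_bound_of_continuousOn hg.continuousOn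
  exact ⟨C, fun x => hC x (mem_univ _)⟩

end SpaceTime

/-! ### Matrix facts -/

section MatrixFacts

variable {N : ℕ}

lemma isHermitian_of_isSymm {A : Mat N} (hA : A.IsSymm) : A.IsHermitian := by
  rw [Matrix.IsHermitian, Matrix.conjTranspose_eq_transpose_of_trivial]
  exact hA

/-- The spectrum of kI - A is k minus the spectrum of A. -/
lemma eigenvaluesLE_of_posSemidef {A : Mat N} {k : ℝ} (h : (k • (1 : Mat N) - A).PosSemidef) :
    EigenvaluesLE A k := by
  intro μ hμ
  have h1 : k - μ ∈ spectrum ℝ (k • (1 : Mat N) - A) := by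
    rw [← Algebra.algebraMap_eq_smul_one, ← spectrum.singleton_sub_eq]
    exact ⟨k, rfl, μ, hμ, rfl⟩
  rw [h.1.spectrum_real_eq_range_eigenvalues] at h1
  obtain ⟨i, hi⟩ := h1
  have := h.eigenvalues_nonneg i
  linarith

lemma trace_le_of_eigenvaluesLE {A : Mat N} (hA : A.IsSymm) {k : ℝ} (h : EigenvaluesLE A k) :
    A.trace ≤ N * k := by
  have hH := isHermitian_of_isSymm hA
  rw [hH.trace_eq_sum_eigenvalues]
  calc ∑ i, ((hH.eigenvalues i : ℝ)) ≤ ∑ _i : Fin N, k := Finset.sum_le_sum fun i _ => by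
        refine h _ ?_
        rw [hH.spectrum_real_eq_range_eigenvalues]
        exact mem_range_self i
    _ = N * k := by simp

lemma frob_smul_right (c : ℝ) (A B : Mat N) : frob A (c • B) = c * frob A B := by
  simp only [frob, Matrix.smul_apply, smul_eq_mul, Finset.mul_sum]
  exact Finset.sum_congr rfl fun _ _ => Finset.sum_congr rfl fun _ _ => by ring

end MatrixFacts

/-! ### Slices of space-time functions -/

section Slices

variable {d : ℕ} {ℓ : Fin d → ℝ} [∀ i, Fact (0 < ℓ i)] {T : ℝ}

lemma ae_ae_of_ae_spaceTime {P : ℝ × Torus ℓ → Prop} (h : ∀ᵐ p ∂(spaceTime ℓ T), P p) :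
    ∀ᵐ x : Torus ℓ, ∀ᵐ t ∂(volume.restrict (Ioo 0 T) : Measure ℝ), P (t, x) :=
  Measure.ae_ae_of_ae_prod (Measure.measurePreserving_swap.quasiMeasurePreserving.ae h)

/-- Slicewise null sets need not be null without measurability, so Fubini is applied to the integral
of the negative part. -/
lemma ae_spaceTime_nonneg_of_ae_ae {f : ℝ × Torus ℓ → ℝ} (hf : Integrable f (spaceTime ℓ T))
    (h : ∀ᵐ x : Torus ℓ, ∀ᵐ t ∂(volume.restrict (Ioo 0 T) : Measure ℝ), 0 ≤ f (t, x)) :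
    ∀ᵐ p ∂(spaceTime ℓ T), 0 ≤ f p := by
  have hg : Integrable (fun p => max (-f p) 0) (spaceTime ℓ T) := hf.neg.pos_part
  have h0 : ∫ p, max (-f p) 0 ∂(spaceTime ℓ T) = 0 := by
    unfold spaceTime at hg ⊢
    rw [integral_prod_symm _ hg]
    refine integral_eq_zero_of_ae (h.mono fun x hx => ?_)
    refine integral_eq_zero_of_ae (hx.mono fun t ht => ?_)
    simpa using ht
  have h1 := (integral_eq_zero_iff_of_nonneg (f := fun p => max (-f p) 0)
    (fun p => le_max_right _ _) hg).1 h0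
  exact h1.mono fun p hp => by simpa using hp

/-- Lebesgue differentiation along intervals with rational endpoints. Countably many tests are
essential later, when each holds only off its own null set of x. -/
lemma ae_nonneg_of_forall_rat_setIntegral_nonneg {g : ℝ → ℝ} (hg : Integrable g)
    (h : ∀ a b : ℚ, 0 ≤ ∫ t in Ioo (a : ℝ) b, g t) : ∀ᵐ t, 0 ≤ g t := by
  filter_upwards [IsUnifLocDoublingMeasure.ae_tendsto_average (volume : Measure ℝ)
    hg.locallyIntegrable 1] with t ht
  have hex : ∀ j : ℕ, ∃ q : ℚ, |t - q| < 1 / ((j : ℝ) + 1) := fun j =>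
    exists_rat_near t Nat.one_div_pos_of_nat
  choose q hq using hex
  -- The intervals contain t but are centred at nearby rationals; the differentiation theorem allows
  -- such off-centre balls.
  have h1 := ht (l := atTop) (fun j : ℕ => (q j : ℝ)) (fun j => 1 / ((j : ℝ) + 1)) ?_ ?_
  · refine ge_of_tendsto h1 (Eventually.of_forall fun j => ?_)
    rw [setAverage_eq, Real.closedBall_eq_Icc, smul_eq_mul, integral_Icc_eq_integral_Ioo]
    refine mul_nonneg (by positivity) ?_
    have := h (q j - 1 / ((j : ℚ) + 1)) (q j + 1 / ((j : ℚ) + 1))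
    push_cast at this
    exact this
  · exact tendsto_nhdsWithin_iff.2 ⟨tendsto_one_div_add_atTop_nhds_zero_nat,
      Eventually.of_forall fun j => mem_Ioi.2 Nat.one_div_pos_of_nat⟩
  · refine Eventually.of_forall fun j => ?_
    rw [one_mul, Metric.mem_closedBall, Real.dist_eq]
    exact (hq j).le

/-- Smooth approximations of the indicator function of `(a, b)`. -/
def smoothCutoff (a b : ℝ) (m : ℕ) (t : ℝ) : ℝ :=
  Real.smoothTransition (m * (t - a)) * Real.smoothTransition (m * (b - t))

lemma smoothCutoff_contDiff (a b : ℝ) (m : ℕ) : ContDiff ℝ ∞ (smoothCutoff a b m) := by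
  have h := Real.smoothTransition.contDiff (n := ⊤)
  exact (h.comp (by fun_prop)).mul (h.comp (by fun_prop))

lemma smoothCutoff_nonneg (a b : ℝ) (m : ℕ) (t : ℝ) : 0 ≤ smoothCutoff a b m t :=
  mul_nonneg (Real.smoothTransition.nonneg _) (Real.smoothTransition.nonneg _)

lemma smoothCutoff_le_one (a b : ℝ) (m : ℕ) (t : ℝ) : smoothCutoff a b m t ≤ 1 :=
  mul_le_one₀ (Real.smoothTransition.le_one _) (Real.smoothTransition.nonneg _)
    (Real.smoothTransition.le_one _)

lemma tendsto_smoothCutoff (a b t : ℝ) :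
    Tendsto (fun m => smoothCutoff a b m t) atTop (𝓝 ((Ioo a b).indicator 1 t)) := by
  by_cases ht : t ∈ Ioo a b
  · rw [indicator_of_mem ht, Pi.one_apply]
    refine tendsto_const_nhds.congr' ?_
    have hev : ∀ s : ℝ, 0 < s → ∀ᶠ m : ℕ in atTop, 1 ≤ (m : ℝ) * s := fun s hs =>
      (tendsto_natCast_atTop_atTop.atTop_mul_const hs).eventually_ge_atTop 1
    filter_upwards [hev _ (sub_pos.2 ht.1), hev _ (sub_pos.2 ht.2)] with m h1 h2
    rw [smoothCutoff, Real.smoothTransition.one_of_one_le h1,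
      Real.smoothTransition.one_of_one_le h2, mul_one]
  · rw [indicator_of_notMem ht]
    refine tendsto_const_nhds.congr fun m => ?_
    rw [mem_Ioo, not_and_or, not_lt, not_lt] at ht
    rcases ht with h | h
    · rw [smoothCutoff, Real.smoothTransition.zero_of_nonpos
        (mul_nonpos_of_nonneg_of_nonpos (Nat.cast_nonneg m) (by linarith)), zero_mul]
    · rw [smoothCutoff, Real.smoothTransition.zero_of_nonpos (x := m * (b - t))
        (mul_nonpos_of_nonneg_of_nonpos (Nat.cast_nonneg m) (by linarith)), mul_zero]

/-- A bounded function on `(0,T)` whose integrals against smooth cut-off functions are nonnegative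
is nonnegative. -/
lemma ae_nonneg_of_forall_smoothCutoff {f : ℝ → ℝ}
    (hf : Integrable f (volume.restrict (Ioo 0 T)))
    (h : ∀ (a b : ℚ) (m : ℕ), 0 ≤ ∫ t in Ioo 0 T, smoothCutoff a b m t * f t) :
    ∀ᵐ t ∂(volume.restrict (Ioo 0 T) : Measure ℝ), 0 ≤ f t := by
  rw [ae_restrict_iff' measurableSet_Ioo]
  have hg : Integrable ((Ioo 0 T).indicator f) :=
    (integrable_indicator_iff measurableSet_Ioo).2 hf
  have := ae_nonneg_of_forall_rat_setIntegral_nonneg hg fun a b => ?_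
  · filter_upwards [this] with t ht hT
    rwa [indicator_of_mem hT] at ht
  · have h1 : Tendsto (fun m => ∫ t in Ioo 0 T, smoothCutoff a b m t * f t) atTop
        (𝓝 (∫ t in Ioo 0 T, (Ioo (a : ℝ) b).indicator 1 t * f t)) := by
      refine tendsto_integral_of_dominated_convergence (fun t => ‖f t‖) (fun m => ?_) hf.norm
        (fun m => Eventually.of_forall fun t => ?_) (Eventually.of_forall fun t => ?_)
      · exact (smoothCutoff_contDiff a b m).continuous.aestronglyMeasurable.mul hf.1
      · rw [norm_mul, Real.norm_of_nonneg (smoothCutoff_nonneg _ _ _ _)]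
        exact mul_le_of_le_one_left (norm_nonneg _) (smoothCutoff_le_one _ _ _ _)
      · exact (tendsto_smoothCutoff a b t).mul_const _
    have h2 := ge_of_tendsto' h1 (h a b)
    have h3 : ∀ t, (Ioo (a : ℝ) b).indicator 1 t * f t = (Ioo (a : ℝ) b).indicator f t := by
      intro t
      by_cases ht : t ∈ Ioo (a : ℝ) b <;> simp [ht]
    simp_rw [h3] at h2
    rw [setIntegral_indicator measurableSet_Ioo] at h2
    rwa [setIntegral_indicator measurableSet_Ioo, inter_comm]

end Slices

/-! ### Uniform bound for the trace of feasible fields -/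

section TraceBound

variable {d n N : ℕ} {ℓ : Fin d → ℝ} [∀ i, Fact (0 < ℓ i)] {T : ℝ} {L : DiffOp d n N}
  {F : Vec n → Mat N} {κ : ℝ → ℝ} {K : Vec n → ℝ}
  {E : ℝ × Torus ℓ → Vec n} {B : ℝ × Torus ℓ → Mat N}

lemma MemOrlicz.integrable_conj (hK : IsNFunction K)
    (hE : MemOrlicz (conj K) E (spaceTime ℓ T)) : Integrable E (spaceTime ℓ T) := by
  obtain ⟨C, -, hC⟩ := hK.exists_norm_le_conj
  exact (hE.2.add (integrable_const C)).mono' hE.1 (Eventually.of_forall fun p => hC _)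

lemma exists_ae_abs_le {α : Type*} [MeasurableSpace α] {μ : Measure α} {f : α → ℝ}
    (hf : MemLp f ∞ μ) : ∃ R, ∀ᵐ p ∂μ, |f p| ≤ R := by
  refine ⟨(eLpNormEssSup f μ).toReal, ?_⟩
  have h := hf.2
  rw [eLpNorm_exponent_top] at h
  filter_upwards [enorm_ae_le_eLpNormEssSup f μ] with p hp
  rw [← Real.norm_eq_abs, ← toReal_enorm]
  exact ENNReal.toReal_mono h.ne hp

/-- The time integral of `E` with a bounded weight belongs to the Orlicz class on `Ω`. -/
lemma memOrlicz_integral_time (hT : 0 < T) (hK : IsNFunction K) (h2 : Delta2 (conj K))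
    (hE : MemOrlicz (conj K) E (spaceTime ℓ T)) {h : ℝ → ℝ} (hh : Continuous h) :
    MemOrlicz (conj K) (fun x => ∫ t in Ioo 0 T, h t • E (t, x)) volume := by
  have hKs := hK.isEvenConvex_conj
  obtain ⟨R, hR⟩ := exists_bound_spaceTime (ℓ := ℓ) (T := T)
    (g := fun p => T * h p.1) (by fun_prop)
  have hm : Continuous fun p : ℝ × Torus ℓ => T * h p.1 := by fun_prop
  have hG := hE.smul hKs h2 hm.aestronglyMeasurable hR
  have hGi := hG.integrable_conj hK
  have hG2 := hG.2
  unfold spaceTime at hGi hG2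
  have hT0 : (volume.restrict (Ioo 0 T) : Measure ℝ).real univ = T := by
    simp [Measure.real, hT.le]
  have : NeZero (volume.restrict (Ioo 0 T) : Measure ℝ) := by
    refine ⟨fun h0 => ?_⟩
    rw [h0] at hT0
    simp at hT0
    exact hT.ne hT0
  -- The factor T turns the time integral into a mean over (0,T), so that Jensen's inequality for K*
  -- applies.
  have heq : ∀ x : Torus ℓ, ∫ t in Ioo 0 T, h t • E (t, x)
      = ⨍ t in Ioo 0 T, (T * h t) • E (t, x) := by
    intro x
    rw [average_eq, hT0]
    simp_rw [mul_smul]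
    rw [integral_smul, smul_smul, inv_mul_cancel₀ hT.ne', one_smul]
  have hmeas : AEStronglyMeasurable (fun x : Torus ℓ => ∫ t in Ioo 0 T, h t • E (t, x)) volume := by
    simp_rw [heq, average_eq, hT0]
    exact hGi.integral_prod_right.1.const_smul T⁻¹
  refine .mono hKs hmeas (hG2.integral_prod_right.const_mul T⁻¹) ?_
  filter_upwards [hGi.prod_left_ae, hG2.prod_left_ae] with x h1 h3
  rw [heq]
  refine (hKs.convex.map_average_le hKs.continuous.continuousOn isClosed_univ
    (Eventually.of_forall fun _ => mem_univ _) h1 h3).trans ?_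
  rw [average_eq, hT0, smul_eq_mul]

lemma posSemidef_smul_sub_neg_of_forall {A : Mat N} (hA : A.IsSymm) {k : ℝ}
    (h : ∀ v : Fin N → ℝ, 0 ≤ k * (v ⬝ᵥ v) + v ⬝ᵥ (A.mulVec v)) :
    (k • (1 : Mat N) - -A).PosSemidef := by
  refine Matrix.PosSemidef.of_dotProduct_mulVec_nonneg ?_ fun v => ?_
  · exact isHermitian_of_isSymm ((Matrix.isSymm_one.smul k).sub hA.neg)
  · have := h v
    simpa [Matrix.add_mulVec, Matrix.smul_mulVec, dotProduct_add] using this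

/-- The time averages of a feasible `B` are values of `L*`. -/
lemma isAdjointValue_integral (hT : 0 < T) (hK : IsNFunction K) (h2 : Delta2 (conj K))
    (hE : MemOrlicz (conj K) E (spaceTime ℓ T)) (hB : ∀ l m, MemLp (fun p => B p l m) ∞
      (spaceTime ℓ T)) (hs : ∀ᵐ p ∂(spaceTime ℓ T), (B p).IsSymm) (hc : WeakConstraint L T E B)
    {h η : ℝ → ℝ} (hh : ContDiff ℝ ∞ h) (hη : Continuous η) (h0 : h 0 = 0)
    (hd : ∀ t, HasDerivAt h (η t) t) :
    IsAdjointValue L K (fun x => -∫ t in Ioo 0 T, h t • E (t, x))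
      (fun x => Matrix.of fun l m => ∫ t in Ioo 0 T, η t * B (t, x) l m) := by
  have hKs := hK.isEvenConvex_conj
  have hmE := memOrlicz_integral_time hT hK h2 hE hh.continuous
  have hηc : Continuous fun p : ℝ × Torus ℓ => η p.1 := by fun_prop
  have hhc : Continuous fun p : ℝ × Torus ℓ => h p.1 := hh.continuous.comp continuous_fst
  obtain ⟨Rη, hRη⟩ := exists_bound_spaceTime (T := T) hηc
  obtain ⟨Rh, hRh⟩ := exists_bound_spaceTime (T := T) hhc
  have hηB : ∀ l m, Integrable (fun p => η p.1 * B p l m) (spaceTime ℓ T) := fun l m =>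
    ((hB l m).integrable le_top).bdd_mul hηc.aestronglyMeasurable hRη
  have hhE : MemOrlicz (conj K) (fun p => h p.1 • E p) (spaceTime ℓ T) :=
    hE.smul hKs h2 hhc.aestronglyMeasurable hRh
  have hhEi := hhE.integrable_conj hK
  have hslE : ∀ᵐ x : Torus ℓ, Integrable (fun t => h t • E (t, x)) (volume.restrict (Ioo 0 T)) := by
    unfold spaceTime at hhEi
    exact hhEi.prod_left_ae
  have hslB : ∀ l m, ∀ᵐ x : Torus ℓ,
      Integrable (fun t => η t * B (t, x) l m) (volume.restrict (Ioo 0 T)) := by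
    intro l m
    have := hηB l m
    unfold spaceTime at this
    exact this.prod_left_ae
  refine ⟨?_, fun l m => ?_, ?_, fun Ψ hΨs hΨ => ?_⟩
  · exact .mono hKs hmE.1.neg hmE.2 (Eventually.of_forall fun x => (hKs.even _).le)
  · obtain ⟨R, hR⟩ := exists_ae_abs_le (hB l m)
    have hi := hηB l m
    unfold spaceTime at hi
    refine MemLp.of_bound hi.integral_prod_right.1
      (Rη * R * (volume.restrict (Ioo 0 T) : Measure ℝ).real univ) ?_
    filter_upwards [ae_ae_of_ae_spaceTime hR, ae_ae_of_ae_spaceTime hRη] with x hx hx2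
    refine norm_integral_le_of_norm_le_const ?_
    filter_upwards [hx, hx2] with t ht ht2
    rw [norm_mul]
    exact mul_le_mul ht2 ht (norm_nonneg _) ((norm_nonneg _).trans ht2)
  · filter_upwards [ae_ae_of_ae_spaceTime hs] with x hx
    ext l m
    simp only [Matrix.transpose_apply, Matrix.of_apply]
    refine integral_congr_ae (hx.mono fun t ht => ?_)
    simp only
    rw [ht.apply]
  · have hLc := L.continuous_apply_space hΨ
    -- The test field hΨ vanishes at time 0 because h(0) = 0. It need not vanish at T, so no
    -- boundary term appears.
    have hcon := hc _ (isTestField_mul hh h0 hΨs hΨ)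
    simp only [timeDeriv_mul hd, DiffOp.apply_smul] at hcon
    have hLE : Integrable (fun p => inner ℝ (h p.1 • E p) (L.apply Ψ p.2)) (spaceTime ℓ T) := by
      obtain ⟨R, hR⟩ := exists_bound_torus hLc
      have hz : MemOrlicz K (fun p : ℝ × Torus ℓ => L.apply Ψ p.2) (spaceTime ℓ T) :=
        .of_bound hK.isEvenConvex (hLc.comp continuous_snd).aestronglyMeasurable
          (Eventually.of_forall fun p => hR p.2)
      simp_rw [real_inner_comm]
      exact hK.integrable_inner hz hhE
    have hterm : ∀ l m, Integrable (fun p => η p.1 * B p l m * Ψ p.2 l m) (spaceTime ℓ T) := by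
      intro l m
      have hΨc := ((hΨ l m).jointSmooth).continuous
      obtain ⟨R, hR⟩ := exists_bound_spaceTime (T := T) hΨc
      exact (hηB l m).mul_bdd hΨc.aestronglyMeasurable hR
    have hfr : ∀ p : ℝ × Torus ℓ, frob (B p) (η p.1 • Ψ p.2)
        = ∑ l, ∑ m, η p.1 * B p l m * Ψ p.2 l m := by
      intro p
      simp only [frob, Matrix.smul_apply, smul_eq_mul]
      exact Finset.sum_congr rfl fun _ _ => Finset.sum_congr rfl fun _ _ => by ring
    have hBi : Integrable (fun p => frob (B p) (η p.1 • Ψ p.2)) (spaceTime ℓ T) := by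
      simp_rw [hfr]
      exact integrable_finsetSum _ fun l _ => integrable_finsetSum _ fun m _ => hterm l m
    have hcomm : ∀ p : ℝ × Torus ℓ, inner ℝ (E p) (h p.1 • L.apply Ψ p.2)
        = inner ℝ (h p.1 • E p) (L.apply Ψ p.2) := fun p => by
      rw [real_inner_smul_left, real_inner_smul_right]
    simp only [hcomm] at hcon
    rw [integral_add hBi hLE] at hcon
    have hL1 : ∫ x, inner ℝ (-∫ t in Ioo 0 T, h t • E (t, x)) (L.apply Ψ x)
        = -∫ p, inner ℝ (h p.1 • E p) (L.apply Ψ p.2) ∂(spaceTime ℓ T) := by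
      unfold spaceTime at hLE ⊢
      rw [integral_prod_symm _ hLE, ← integral_neg]
      refine integral_congr_ae (hslE.mono fun x hx => ?_)
      simp only
      rw [inner_neg_left, real_inner_comm, ← integral_inner hx]
      simp_rw [real_inner_comm]
    have hR1 : ∫ x, frob (Matrix.of fun l m => ∫ t in Ioo 0 T, η t * B (t, x) l m) (Ψ x)
        = ∫ p, frob (B p) (η p.1 • Ψ p.2) ∂(spaceTime ℓ T) := by
      unfold spaceTime at hBi ⊢
      rw [integral_prod_symm _ hBi]
      have hall : ∀ᵐ x : Torus ℓ, ∀ l m,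
          Integrable (fun t => η t * B (t, x) l m) (volume.restrict (Ioo 0 T)) :=
        ae_all_iff.2 fun l => ae_all_iff.2 fun m => hslB l m
      refine integral_congr_ae (hall.mono fun x hx => ?_)
      simp only [hfr]
      rw [integral_finsetSum _ fun l _ => integrable_finsetSum _ fun m _ =>
        (hx l m).mul_const (Ψ x l m)]
      simp only [frob, Matrix.of_apply]
      refine Finset.sum_congr rfl fun l _ => ?_
      rw [integral_finsetSum _ fun m _ => (hx l m).mul_const (Ψ x l m)]
      exact Finset.sum_congr rfl fun m _ => (integral_mul_const _ _).symm
    rw [hL1, hR1]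
    linarith

lemma dotProduct_mulVec_of_integral {X : Type*} [MeasurableSpace X] {μ : Measure X}
    {A : X → Mat N} (hA : ∀ l m, Integrable (fun t => A t l m) μ) (v : Fin N → ℝ) :
    Integrable (fun t => v ⬝ᵥ (A t).mulVec v) μ ∧
    v ⬝ᵥ (Matrix.of fun l m => ∫ t, A t l m ∂μ).mulVec v = ∫ t, v ⬝ᵥ (A t).mulVec v ∂μ := by
  simp only [dotProduct, Matrix.mulVec, Finset.mul_sum, Matrix.of_apply]
  have hi : ∀ l m, Integrable (fun t => v l * (A t l m * v m)) μ := fun l m =>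
    ((hA l m).mul_const _).const_mul _
  refine ⟨integrable_finsetSum _ fun l _ => integrable_finsetSum _ fun m _ => hi l m, ?_⟩
  rw [integral_finsetSum _ fun l _ => integrable_finsetSum _ fun m _ => hi l m]
  refine Finset.sum_congr rfl fun l _ => ?_
  rw [integral_finsetSum _ fun m _ => hi l m]
  refine Finset.sum_congr rfl fun m _ => ?_
  rw [integral_const_mul, integral_mul_const]

/-- The strong trace condition bounds the traces of all feasible `B` uniformly from above. -/
theorem exists_trace_le (hT : 0 < T) (hK : IsNFunction (entropy F)) (h2 : Delta2 (conj (entropy F)))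
    (hL : StrongTrace ℓ L (entropy F)) (hκ : IsWeight κ T) :
    ∃ C, ∀ (E : ℝ × Torus ℓ → Vec n) (B : ℝ × Torus ℓ → Mat N), IsDualFeasible L F κ T E B →
      ∀ᵐ p ∂(spaceTime ℓ T), (B p).trace ≤ C := by
  obtain ⟨c, hc⟩ := hL
  obtain ⟨b, hb⟩ := hκ.upper
  refine ⟨N * (c * (b / 2)), fun E B hEB => ?_⟩
  set C := N * (c * (b / 2)) with hC
  have hBi : ∀ l m, Integrable (fun p => B p l m) (spaceTime ℓ T) := fun l m =>
    (hEB.memLp l m).integrable le_top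
  have htr : Integrable (fun p => C - (B p).trace) (spaceTime ℓ T) :=
    (integrable_const C).sub (integrable_finsetSum _ fun l _ => hBi l l)
  suffices h : ∀ᵐ p ∂(spaceTime ℓ T), 0 ≤ C - (B p).trace by
    exact h.mono fun p hp => sub_nonneg.1 hp
  refine ae_spaceTime_nonneg_of_ae_ae htr ?_
  have hslB : ∀ᵐ x : Torus ℓ, ∀ l m,
      Integrable (fun t => B (t, x) l m) (volume.restrict (Ioo 0 T)) := by
    refine ae_all_iff.2 fun l => ae_all_iff.2 fun m => ?_
    have := hBi l m
    unfold spaceTime at this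
    exact this.prod_left_ae
  have hκt : ∀ᵐ t ∂(volume.restrict (Ioo 0 T) : Measure ℝ), κ t ≤ b :=
    (ae_restrict_mem measurableSet_Ioo).mono fun t ht => hb t (Ioo_subset_Icc_self ht)
  have hmain : ∀ (r s : ℚ) (m : ℕ), ∀ᵐ x : Torus ℓ,
      0 ≤ ∫ t in Ioo 0 T, smoothCutoff r s m t * (C - (B (t, x)).trace) := by
    intro r s m
    set η := smoothCutoff r s m with hη
    have hηs : ContDiff ℝ ∞ η := smoothCutoff_contDiff r s m
    have hηc := hηs.continuous
    have hη0 : ∀ t, 0 ≤ η t := smoothCutoff_nonneg r s m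
    have hηi : Integrable η (volume.restrict (Ioo 0 T)) :=
      (hηc.integrableOn_Icc (a := 0) (b := T)).mono_set Ioo_subset_Icc_self
    -- The primitive of η vanishing at 0, so that hΨ is a test field with time derivative ηΨ.
    set h : ℝ → ℝ := fun t => ∫ s in (0 : ℝ)..t, η s with hh
    have hd : ∀ t, HasDerivAt h (η t) t := fun t =>
      intervalIntegral.integral_hasDerivAt_right (hηc.intervalIntegrable _ _)
        (hηc.stronglyMeasurableAtFilter _ _) hηc.continuousAt
    have hhs : ContDiff ℝ ∞ h := by
      rw [contDiff_infty_iff_deriv]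
      refine ⟨fun t => (hd t).differentiableAt, ?_⟩
      rwa [show deriv h = η from funext fun t => (hd t).deriv]
    have hadj := isAdjointValue_integral hT hK h2 hEB.mem_orlicz hEB.memLp hEB.symm
      hEB.constraint hhs hηc (by simp [hh]) hd
    -- Since κ ≤ b, the constraint gives -B ⪯ (b/2) I, and averaging against η ≥ 0 gives -G ⪯ k I.
    set k := b / 2 * ∫ t in Ioo 0 T, η t with hk
    set G : Torus ℓ → Mat N :=
      fun x => Matrix.of fun l m => ∫ t in Ioo 0 T, η t * B (t, x) l m with hG
    have hηB : ∀ᵐ x : Torus ℓ, ∀ l m,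
        Integrable (fun t => (η t • B (t, x)) l m) (volume.restrict (Ioo 0 T)) := by
      filter_upwards [hslB] with x hx l m
      refine (hx l m).bdd_mul (c := 1) hηc.aestronglyMeasurable (Eventually.of_forall fun t => ?_)
      rw [Real.norm_of_nonneg (hη0 t)]
      exact smoothCutoff_le_one r s _ t
    have hlow : ∀ᵐ x, EigenvaluesLE (-(G x)) k := by
      filter_upwards [hηB, hadj.symm, ae_ae_of_ae_spaceTime hEB.posSemidef] with x hx hsx hpx
      refine eigenvaluesLE_of_posSemidef (posSemidef_smul_sub_neg_of_forall hsx fun v => ?_)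
      obtain ⟨h3, h4⟩ := dotProduct_mulVec_of_integral hx v
      have h5 : v ⬝ᵥ (G x).mulVec v
          = ∫ t in Ioo 0 T, v ⬝ᵥ (η t • B (t, x)).mulVec v := h4
      have h6 : k * (v ⬝ᵥ v) = ∫ t in Ioo 0 T, b / 2 * (v ⬝ᵥ v) * η t := by
        rw [integral_const_mul, hk]; ring
      rw [h5, h6, ← integral_add (hηi.const_mul _) h3]
      refine integral_nonneg_of_ae ?_
      filter_upwards [hpx, hκt] with t ht hkt
      have h7 := ht.dotProduct_mulVec_nonneg v
      simp only [star_trivial, Matrix.add_mulVec, Matrix.smul_mulVec, Matrix.one_mulVec,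
        dotProduct_add, dotProduct_smul, smul_eq_mul] at h7
      simp only [Matrix.smul_mulVec, dotProduct_smul, smul_eq_mul, Pi.zero_apply]
      have hvv : 0 ≤ v ⬝ᵥ v := by
        simpa using dotProduct_star_self_nonneg v
      have h8 : 0 ≤ b / 2 * (v ⬝ᵥ v) + v ⬝ᵥ (B (t, x)).mulVec v := by
        nlinarith [mul_le_mul_of_nonneg_right hkt hvv]
      nlinarith [mul_nonneg (hη0 t) h8]
    filter_upwards [hc _ _ hadj k hlow, hadj.symm, hslB, hηB] with x hx hsx hBx hηx
    have h3 := trace_le_of_eigenvaluesLE hsx hx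
    have h4 : (G x).trace = ∫ t in Ioo 0 T, η t * (B (t, x)).trace := by
      simp only [Matrix.trace, Matrix.diag, hG, Matrix.of_apply, Finset.mul_sum]
      exact (integral_finsetSum _ fun l _ => hηx l l).symm
    have h5 : Integrable (fun t => η t * (B (t, x)).trace) (volume.restrict (Ioo 0 T)) := by
      simp only [Matrix.trace, Matrix.diag, Finset.mul_sum]
      exact integrable_finsetSum _ fun l _ => hηx l l
    simp_rw [mul_sub]
    rw [integral_sub (hηi.mul_const C) h5, integral_mul_const, ← h4]
    have h6 : (N : ℝ) * (c * k) = (∫ t in Ioo 0 T, η t) * C := by rw [hk, hC]; ring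
    linarith
  -- Only countably many cut-offs occur, so one null set of x serves for all of them.
  have hall : ∀ᵐ x : Torus ℓ, ∀ (r s : ℚ) (m : ℕ),
      0 ≤ ∫ t in Ioo 0 T, smoothCutoff r s m t * (C - (B (t, x)).trace) :=
    ae_all_iff.2 fun r => ae_all_iff.2 fun s => ae_all_iff.2 fun m => hmain r s m
  unfold spaceTime at htr
  filter_upwards [hall, htr.prod_left_ae] with x hx hix
  exact ae_nonneg_of_forall_smoothCutoff hix hx

end TraceBound

/-! ### The Frobenius product and positive semidefinite matrices -/

section MatrixBounds

variable {N : ℕ}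

lemma frob_one_right (A : Mat N) : frob A 1 = A.trace := by
  simp [frob, Matrix.trace, Matrix.one_apply]

lemma frob_comm (A B : Mat N) : frob A B = frob B A := by
  simp only [frob, mul_comm]

lemma frob_sub_left (A B P : Mat N) : frob (A - B) P = frob A P - frob B P := by
  simp [frob, sub_mul, Finset.sum_sub_distrib]

lemma frob_sub_right (A P R : Mat N) : frob A (P - R) = frob A P - frob A R := by
  simp [frob, mul_sub, Finset.sum_sub_distrib]

lemma frob_add_right (A P R : Mat N) : frob A (P + R) = frob A P + frob A R := by
  simp [frob, mul_add, Finset.sum_add_distrib]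

lemma frob_smul_one_left (c : ℝ) (P : Mat N) : frob (c • (1 : Mat N)) P = c * P.trace := by
  rw [frob_comm, frob_smul_right, frob_one_right]

/-- No eigenvalue of P exceeds the trace, because the others are nonnegative. -/
lemma posSemidef_trace_smul_one_sub {P : Mat N} (hP : P.PosSemidef) :
    (P.trace • (1 : Mat N) - P).PosSemidef := by
  have hs : P.IsSymm := by
    have := hP.1
    rwa [Matrix.IsHermitian, Matrix.conjTranspose_eq_transpose_of_trivial] at this
  have hH : (P.trace • (1 : Mat N) - P).IsHermitian :=
    isHermitian_of_isSymm ((Matrix.isSymm_one.smul _).sub hs)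
  rw [hH.posSemidef_iff_eigenvalues_nonneg]
  intro i
  rw [Pi.zero_apply]
  have h1 : hH.eigenvalues i ∈ spectrum ℝ (P.trace • (1 : Mat N) - P) := by
    rw [hH.spectrum_real_eq_range_eigenvalues]; exact mem_range_self i
  generalize hH.eigenvalues i = e at h1 ⊢
  rw [← Algebra.algebraMap_eq_smul_one, ← spectrum.singleton_sub_eq,
    hP.1.spectrum_real_eq_range_eigenvalues] at h1
  obtain ⟨a, ha, _, ⟨j, rfl⟩, h⟩ := h1
  rw [mem_singleton_iff] at ha
  have h2 : hP.1.eigenvalues j ≤ P.trace := by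
    rw [hP.1.trace_eq_sum_eigenvalues]
    exact Finset.single_le_sum (f := fun j => ((hP.1.eigenvalues j : ℝ)))
      (fun j _ => hP.eigenvalues_nonneg j) (Finset.mem_univ j)
  rw [← h, ha]
  exact sub_nonneg.2 h2

lemma abs_apply_le_trace {P : Mat N} (hP : P.PosSemidef) (l m : Fin N) : |P l m| ≤ P.trace := by
  have hs : P m l = P l m := by
    have := hP.1
    rw [Matrix.IsHermitian, Matrix.conjTranspose_eq_transpose_of_trivial] at this
    exact Matrix.IsSymm.apply this l m
  have hd : ∀ i, P i i ≤ P.trace := fun i =>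
    Finset.single_le_sum (f := fun j => P j j) (fun j _ => hP.diag_nonneg) (Finset.mem_univ i)
  have hq : ∀ a b : ℝ, 0 ≤ a * a * P l l + 2 * (a * b) * P l m + b * b * P m m := by
    intro a b
    have h := hP.dotProduct_mulVec_nonneg (Pi.single l a + Pi.single m b)
    simp only [star_trivial, Matrix.mulVec_add, dotProduct_add, add_dotProduct,
      single_dotProduct, Matrix.mulVec_single, Pi.smul_apply, Matrix.col_apply,
      MulOpposite.smul_eq_mul_unop, MulOpposite.unop_op, hs] at h
    linarith
  -- The quadratic form at e_l ± e_m gives 2|P_lm| ≤ P_ll + P_mm.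
  have h1 := hq 1 1
  have h2 := hq 1 (-1)
  have h3 := hd l
  have h4 := hd m
  rw [abs_le]
  constructor <;> linarith

end MatrixBounds

/-! ### The Lagrangian of the dual problem -/

section Lagrangian

variable {d n N : ℕ} {ℓ : Fin d → ℝ} {L : DiffOp d n N} {F : Vec n → Mat N}

lemma one_mem_Lam : (1 : Mat N) ∈ L.Lam ℓ := Submodule.subset_span (Or.inl rfl)

lemma trace_flux (F : Vec n → Mat N) (v : Vec n) :
    (F v).trace = 2 * entropy F v + (F 0).trace := by
  simp only [entropy, Matrix.trace_sub]; ring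

lemma trace_flux_nonneg (hF : IsAdmissibleFlux (L.Lam ℓ) F) (v : Vec n) : 0 ≤ (F v).trace := by
  rw [← frob_one_right]
  exact (hF.lam_nonneg v).2 1 one_mem_Lam Matrix.PosSemidef.one

/-- For P ⪰ 0 in Λ the matrix (tr P) I - P is again positive semidefinite, and it lies in Λ because
I does. Positivity of F against it is the claim. This supplies an admissible M for every z. -/
lemma flux_le_trace (hF : IsAdmissibleFlux (L.Lam ℓ) F) (v : Vec n) :
    LamLE (L.Lam ℓ) (F v) ((F v).trace • (1 : Mat N)) := by
  refine ⟨(Matrix.isSymm_one.smul _).sub (hF.symm v), fun P hP hPs => ?_⟩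
  have h := (hF.lam_nonneg v).2 (P.trace • 1 - P)
    (Submodule.sub_mem _ (Submodule.smul_mem _ _ one_mem_Lam) hP)
    (posSemidef_trace_smul_one_sub hPs)
  rw [frob_sub_right, frob_smul_right, frob_one_right] at h
  rw [frob_sub_left, frob_smul_one_left]
  linarith

variable [∀ i, Fact (0 < ℓ i)] {T : ℝ} {κ : ℝ → ℝ} {v₀ : Torus ℓ → Vec n}
  {E : ℝ × Torus ℓ → Vec n} {B : ℝ × Torus ℓ → Mat N}
  {z : ℝ × Torus ℓ → Vec n} {M : ℝ × Torus ℓ → Mat N}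

lemma integrable_trace_flux (hz : MemOrlicz (entropy F) z (spaceTime ℓ T)) :
    Integrable (fun p => (F (z p)).trace) (spaceTime ℓ T) := by
  simp_rw [trace_flux F (z _)]
  exact (hz.2.const_mul 2).add (integrable_const _)

lemma isPrimalPair_trace (hF : IsAdmissibleFlux (L.Lam ℓ) F)
    (hz : MemOrlicz (entropy F) z (spaceTime ℓ T)) :
    IsPrimalPair L F T z (fun p => (F (z p)).trace • (1 : Mat N)) where
  mem_orlicz := hz
  integrable _ _ := (integrable_trace_flux hz).mul_const _
  symm := Eventually.of_forall fun _ => Matrix.isSymm_one.smul _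
  flux_le := Eventually.of_forall fun _ => flux_le_trace hF _

lemma memOrlicz_comp_snd {K : Vec n → ℝ} (hv₀ : MemOrlicz K v₀ volume) :
    MemOrlicz K (fun p : ℝ × Torus ℓ => v₀ p.2) (spaceTime ℓ T) :=
  ⟨hv₀.1.comp_snd, hv₀.2.comp_snd _⟩

/-- The Lagrangian whose infimum over primal pairs is the dual objective. -/
def lagrangian (κ : ℝ → ℝ) (T : ℝ) (v₀ : Torus ℓ → Vec n) (E : ℝ × Torus ℓ → Vec n)
    (B : ℝ × Torus ℓ → Mat N) (z : ℝ × Torus ℓ → Vec n) (M : ℝ × Torus ℓ → Mat N) : ℝ :=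
  -∫ p, inner ℝ (v₀ p.2) (E p) ∂(spaceTime ℓ T)
    + ∫ p, (inner ℝ (z p) (E p) + frob (M p) (κ p.1 • (1 : Mat N) + (2 : ℝ) • B p) / 2)
      ∂(spaceTime ℓ T)

/-- Concavity and upper semicontinuity of the objective reduce through this to properties of single
Lagrangians, which are real-valued. -/
lemma le_dualObjective_iff (c : ℝ) :
    (c : EReal) ≤ dualObjective L F κ T v₀ E B ↔
      ∀ z M, IsPrimalPair L F T z M → c ≤ lagrangian κ T v₀ E B z M := by
  unfold dualObjective innerValue lagrangian
  -- The term with v₀ is a real number, so moving it across the inequality is legitimate in `EReal`.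
  rw [add_comm, ← EReal.sub_le_iff_le_add (by simp) (by simp), ← EReal.coe_sub, le_iInf_iff]
  refine forall_congr' fun z => ?_
  rw [le_iInf_iff]
  refine forall_congr' fun M => ?_
  rw [le_iInf_iff]
  refine forall_congr' fun _ => ?_
  rw [EReal.coe_le_coe_iff, sub_le_iff_le_add']

lemma dualObjective_le_lagrangian (h : IsPrimalPair L F T z M) :
    dualObjective L F κ T v₀ E B ≤ lagrangian κ T v₀ E B z M := by
  unfold dualObjective innerValue lagrangian
  rw [EReal.coe_add]
  refine add_le_add le_rfl ?_
  exact (iInf_le _ z).trans ((iInf_le _ M).trans (iInf_le _ h))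

lemma IsWeight.exists_abs_le (hκ : IsWeight κ T) :
    ∃ b, 0 ≤ b ∧ (∀ t ∈ Icc 0 T, κ t ≤ b) ∧ ∀ᵐ p ∂(spaceTime ℓ T), |κ p.1| ≤ b := by
  obtain ⟨b, hb⟩ := hκ.upper
  obtain ⟨a, ha, hab⟩ := hκ.lower
  refine ⟨max b 0, le_max_right _ _, fun t ht => (hb t ht).trans (le_max_left _ _), ?_⟩
  filter_upwards [ae_spaceTime_mem (ℓ := ℓ) (T := T)] with p hp
  have hp' := Ioo_subset_Icc_self hp
  rw [abs_of_nonneg (ha.le.trans (hab _ hp'))]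
  exact (hb _ hp').trans (le_max_left _ _)

lemma IsWeight.aestronglyMeasurable (hκ : IsWeight κ T) :
    AEStronglyMeasurable (fun p : ℝ × Torus ℓ => κ p.1) (spaceTime ℓ T) :=
  (hκ.measurable.mono_measure (Measure.restrict_mono Ioo_subset_Icc_self le_rfl)).comp_fst

lemma integrable_frob (hκ : IsWeight κ T) (hM : ∀ l m, Integrable (fun p => M p l m) (spaceTime ℓ T))
    (hB : ∀ l m, MemLp (fun p => B p l m) ∞ (spaceTime ℓ T)) :
    Integrable (fun p => frob (M p) (κ p.1 • (1 : Mat N) + (2 : ℝ) • B p) / 2)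
      (spaceTime ℓ T) := by
  obtain ⟨b, -, -, hb⟩ := hκ.exists_abs_le (ℓ := ℓ)
  refine Integrable.div_const ?_ _
  refine integrable_finsetSum _ fun l _ => integrable_finsetSum _ fun m _ => ?_
  obtain ⟨R, hR⟩ := exists_ae_abs_le (hB l m)
  refine (hM l m).mul_bdd (c := b * |(1 : Mat N) l m| + 2 * R) ?_ ?_
  · exact (hκ.aestronglyMeasurable.mul_const _).add ((hB l m).1.const_mul 2)
  · filter_upwards [hb, hR] with p h1 h2
    simp only [Matrix.add_apply, Matrix.smul_apply, smul_eq_mul]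
    refine (norm_add_le _ _).trans (add_le_add ?_ ?_)
    · rw [norm_mul]
      exact mul_le_mul_of_nonneg_right h1 (norm_nonneg _)
    · rw [norm_mul, Real.norm_of_nonneg zero_le_two]
      exact mul_le_mul_of_nonneg_left h2 zero_le_two

end Lagrangian

section Coercivity

variable {d n N : ℕ} {ℓ : Fin d → ℝ} [∀ i, Fact (0 < ℓ i)] {T : ℝ} {L : DiffOp d n N}
  {F : Vec n → Mat N} {κ : ℝ → ℝ} {v₀ : Torus ℓ → Vec n}
  {E : ℝ × Torus ℓ → Vec n} {B : ℝ × Torus ℓ → Mat N}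
  {z : ℝ × Torus ℓ → Vec n}

/-! ### Uniform bounds for feasible pairs -/

lemma exists_multiplier_trace_le (hF : IsAdmissibleFlux (L.Lam ℓ) F)
    (hL : StrongTrace ℓ L (entropy F)) (hT : 0 < T) (hκ : IsWeight κ T) :
    ∃ C, 0 ≤ C ∧ ∀ (E : ℝ × Torus ℓ → Vec n) (B : ℝ × Torus ℓ → Mat N),
      IsDualFeasible L F κ T E B →
      ∀ᵐ p ∂(spaceTime ℓ T), (κ p.1 • (1 : Mat N) + (2 : ℝ) • B p).trace ≤ C := by
  obtain ⟨C, hC⟩ := exists_trace_le hT hF.entropy_nFunction hF.conj_delta2 hL hκ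
  obtain ⟨b, hb0, -, hb⟩ := hκ.exists_abs_le (ℓ := ℓ)
  refine ⟨max (b * N + 2 * C) 0, le_max_right _ _, fun E B hEB => ?_⟩
  filter_upwards [hC E B hEB, hb] with p h1 h2
  refine le_trans ?_ (le_max_left _ _)
  simp only [Matrix.trace_add, Matrix.trace_smul, Matrix.trace_one, Fintype.card_fin, smul_eq_mul]
  have := mul_le_mul_of_nonneg_right ((le_abs_self _).trans h2) (Nat.cast_nonneg (α := ℝ) N)
  linarith

lemma exists_abs_apply_le (hF : IsAdmissibleFlux (L.Lam ℓ) F)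
    (hL : StrongTrace ℓ L (entropy F)) (hT : 0 < T) (hκ : IsWeight κ T) :
    ∃ R, ∀ (E : ℝ × Torus ℓ → Vec n) (B : ℝ × Torus ℓ → Mat N),
      IsDualFeasible L F κ T E B → ∀ᵐ p ∂(spaceTime ℓ T), ∀ l m, |B p l m| ≤ R := by
  obtain ⟨C, -, hC⟩ := exists_multiplier_trace_le hF hL hT hκ
  obtain ⟨b, hb0, -, hb⟩ := hκ.exists_abs_le (ℓ := ℓ)
  refine ⟨(C + b) / 2, fun E B hEB => ?_⟩
  filter_upwards [hC E B hEB, hEB.posSemidef, hb] with p h1 h2 h3 l m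
  have h4 := (abs_apply_le_trace h2 l m).trans h1
  simp only [Matrix.add_apply, Matrix.smul_apply, smul_eq_mul] at h4
  have h5 : |κ p.1 * (1 : Mat N) l m| ≤ b := by
    rw [abs_mul]
    refine (mul_le_of_le_one_right (abs_nonneg _) ?_).trans h3
    rw [Matrix.one_apply]
    split_ifs <;> simp
  rw [abs_le] at h4 h5 ⊢
  constructor <;> linarith [h4.1, h4.2, h5.1, h5.2]

/-- For M = tr F(z) I the matrix term is tr F(z) tr(κI + 2B)/2, and tr F(z) ≥ 0 lets the second
trace be replaced by its bound. -/
lemma lagrangian_trace_le (hF : IsAdmissibleFlux (L.Lam ℓ) F) (hκ : IsWeight κ T)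
    (hv₀ : MemOrlicz (entropy F) v₀ volume) (hEB : IsDualFeasible L F κ T E B)
    (hz : MemOrlicz (entropy F) z (spaceTime ℓ T)) {C : ℝ}
    (hC : ∀ᵐ p ∂(spaceTime ℓ T), (κ p.1 • (1 : Mat N) + (2 : ℝ) • B p).trace ≤ C) :
    lagrangian κ T v₀ E B z (fun p => (F (z p)).trace • (1 : Mat N))
      ≤ ∫ p, inner ℝ (z p - v₀ p.2) (E p) ∂(spaceTime ℓ T)
        + C / 2 * ∫ p, (F (z p)).trace ∂(spaceTime ℓ T) := by
  have hK := hF.entropy_nFunction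
  have h1 := hK.integrable_inner hz hEB.mem_orlicz
  have h2 := hK.integrable_inner (memOrlicz_comp_snd (T := T) hv₀) hEB.mem_orlicz
  have h3 := integrable_frob (M := fun p => (F (z p)).trace • (1 : Mat N)) hκ
    (isPrimalPair_trace hF hz).integrable hEB.memLp
  simp_rw [inner_sub_left]
  rw [lagrangian, integral_add h1 h3, integral_sub h1 h2]
  have h4 : ∫ p, frob ((F (z p)).trace • (1 : Mat N)) (κ p.1 • (1 : Mat N) + (2 : ℝ) • B p) / 2
      ∂(spaceTime ℓ T) ≤ C / 2 * ∫ p, (F (z p)).trace ∂(spaceTime ℓ T) := by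
    rw [← integral_const_mul]
    refine integral_mono_ae h3 ((integrable_trace_flux hz).const_mul _) ?_
    filter_upwards [hC] with p hp
    rw [frob_smul_one_left]
    have := mul_le_mul_of_nonneg_left hp (trace_flux_nonneg hF (z p))
    linarith
  linarith

/-- Superlevel sets of the dual objective are bounded in `L_{K*}`. -/
theorem exists_integral_conj_le (hF : IsAdmissibleFlux (L.Lam ℓ) F)
    (hL : StrongTrace ℓ L (entropy F)) (hT : 0 < T) (hκ : IsWeight κ T)
    (hv₀ : MemOrlicz (entropy F) v₀ volume) (c : ℝ) :
    ∃ C, ∀ (E : ℝ × Torus ℓ → Vec n) (B : ℝ × Torus ℓ → Mat N),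
      IsDualFeasible L F κ T E B → (c : EReal) ≤ dualObjective L F κ T v₀ E B →
      ∫ p, conj (entropy F) (E p) ∂(spaceTime ℓ T) ≤ C := by
  set K := entropy F
  have hK : IsNFunction K := hF.entropy_nFunction
  have hKe := hK.isEvenConvex
  have hKs := hK.isEvenConvex_conj
  have hK2 : Delta2 K := hF.entropy_delta2
  have hKs2 : Delta2 (conj K) := hF.conj_delta2
  obtain ⟨C₁, hC₁, hC⟩ := exists_multiplier_trace_le hF hL hT hκ
  -- The summand 1 makes a strictly positive, so that E can be divided by it.
  set a := C₁ + 1 with ha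
  have ha0 : 0 < a := by linarith
  obtain ⟨D, hD, hDK⟩ := hKs.exists_smul_le hKs2 a
  have hv : MemOrlicz K (fun p : ℝ × Torus ℓ => v₀ p.2) (spaceTime ℓ T) := memOrlicz_comp_snd hv₀
  have hv2 := (hv.const_smul hKe hK2 2).2
  set A := ∫ p, (K ((2 : ℝ) • v₀ p.2) + (F 0).trace) ∂(spaceTime ℓ T) with hA
  have hvA : Integrable (fun p : ℝ × Torus ℓ => K ((2 : ℝ) • v₀ p.2) + (F 0).trace)
      (spaceTime ℓ T) := hv2.add (integrable_const _)
  obtain ⟨U, hUm, hUb, hU0, hUt⟩ := hK.exists_selection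
  -- Solving c ≤ -(a/2) ∫ w·y + (a/2)(A + ∫ K(w)) for ∫ (w·y - K(w)).
  set S := 2 / a * (-c) + A with hS
  refine ⟨D * (S + (spaceTime ℓ T).real univ), fun E B hEB hobj => ?_⟩
  rw [le_dualObjective_iff] at hobj
  have hE : MemOrlicz (conj K) E (spaceTime ℓ T) := hEB.mem_orlicz
  set y : ℝ × Torus ℓ → Vec n := fun p => a⁻¹ • E p with hy
  have hyO : MemOrlicz (conj K) y (spaceTime ℓ T) := hE.const_smul hKs hKs2 a⁻¹
  have hEy : ∀ p, E p = a • y p := fun p => by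
    simp only [hy]; rw [smul_smul, mul_inv_cancel₀ ha0.ne', one_smul]
  have hUy : ∀ m, MemOrlicz K (fun p => U m (y p)) (spaceTime ℓ T) := fun m => by
    obtain ⟨R, hR⟩ := hUb m
    exact .of_bound hKe ((hUm m).comp_aemeasurable hyO.1.aemeasurable).aestronglyMeasurable
      (Eventually.of_forall fun p => hR _)
  have hgI : ∀ m, Integrable (fun p => inner ℝ (U m (y p)) (y p) - K (U m (y p)))
      (spaceTime ℓ T) := fun m => (hK.integrable_inner (hUy m) hyO).sub (hUy m).2
  have hbound : ∀ m, ∫ p, (inner ℝ (U m (y p)) (y p) - K (U m (y p))) ∂(spaceTime ℓ T) ≤ S := by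
    intro m
    -- The competitor is z = v₀ - w/2 with w = U m (y). The factor 1/2 gives 2K(z) ≤ K(2v₀) + K(w),
    -- with exactly the coefficient of K(w) needed for the Legendre transform.
    have hw := (hUy m).const_smul hKe hK2 (1 / 2)
    have hz := hv.sub hKe hK2 hw
    have h1 := (hobj _ _ (isPrimalPair_trace hF hz)).trans
      (lagrangian_trace_le hF hκ hv₀ hEB hz (hC E B hEB))
    have h2 : ∀ p : ℝ × Torus ℓ,
        inner ℝ (v₀ p.2 - (1 / 2 : ℝ) • U m (y p) - v₀ p.2) (E p)
          = -(a / 2) * inner ℝ (U m (y p)) (y p) := by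
      intro p
      rw [sub_sub_cancel_left, hEy, inner_neg_left, real_inner_smul_left, real_inner_smul_right]
      ring
    simp_rw [h2] at h1
    rw [integral_const_mul] at h1
    have h3 : ∫ p, (F (v₀ p.2 - (1 / 2 : ℝ) • U m (y p))).trace ∂(spaceTime ℓ T)
        ≤ A + ∫ p, K (U m (y p)) ∂(spaceTime ℓ T) := by
      rw [hA, ← integral_add hvA (hUy m).2]
      refine integral_mono (integrable_trace_flux hz)
        (hvA.add (hUy m).2) fun p => ?_
      have h4 := hKe.sub_le (v₀ p.2) ((1 / 2 : ℝ) • U m (y p))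
      rw [smul_smul, show (2 : ℝ) * (1 / 2) = 1 by norm_num, one_smul] at h4
      simp only
      rw [trace_flux F (v₀ p.2 - _)]
      linarith
    have h0 : 0 ≤ ∫ p, (F (v₀ p.2 - (1 / 2 : ℝ) • U m (y p))).trace ∂(spaceTime ℓ T) :=
      integral_nonneg fun p => trace_flux_nonneg hF _
    rw [integral_sub (hK.integrable_inner (hUy m) hyO) (hUy m).2]
    have h5 : C₁ / 2 * ∫ p, (F (v₀ p.2 - (1 / 2 : ℝ) • U m (y p))).trace ∂(spaceTime ℓ T)
        ≤ a / 2 * (A + ∫ p, K (U m (y p)) ∂(spaceTime ℓ T)) := by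
      calc _ ≤ a / 2 * ∫ p, (F (v₀ p.2 - (1 / 2 : ℝ) • U m (y p))).trace ∂(spaceTime ℓ T) :=
            mul_le_mul_of_nonneg_right (by linarith) h0
        _ ≤ _ := mul_le_mul_of_nonneg_left h3 (by linarith)
    rw [hS]
    have h6 : a / 2 * (∫ p, inner ℝ (U m (y p)) (y p) ∂(spaceTime ℓ T)
        - ∫ p, K (U m (y p)) ∂(spaceTime ℓ T)) ≤ a / 2 * (2 / a * (-c) + A) := by
      have : a / 2 * (2 / a * (-c) + A) = -c + a / 2 * A := by field_simp
      rw [this]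
      linarith
    exact le_of_mul_le_mul_left h6 (by linarith)
  have hlim : Tendsto (fun m => ∫ p, (inner ℝ (U m (y p)) (y p) - K (U m (y p)))
      ∂(spaceTime ℓ T)) atTop (𝓝 (∫ p, conj K (y p) ∂(spaceTime ℓ T))) := by
    refine tendsto_integral_of_dominated_convergence _ (fun m => (hgI m).1) hyO.2
      (fun m => Eventually.of_forall fun p => ?_) (Eventually.of_forall fun p => hUt _)
    rw [Real.norm_of_nonneg (hU0 m _)]
    linarith [hK.inner_le (U m (y p)) (y p)]
  have hyS : ∫ p, conj K (y p) ∂(spaceTime ℓ T) ≤ S := le_of_tendsto' hlim hbound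
  calc ∫ p, conj K (E p) ∂(spaceTime ℓ T)
      ≤ ∫ p, D * (conj K (y p) + 1) ∂(spaceTime ℓ T) := by
        refine integral_mono hE.2 ((hyO.2.add (integrable_const 1)).const_mul D) fun p => ?_
        simp only
        rw [hEy]
        exact hDK _ _ (abs_of_pos ha0).le
    _ = D * (∫ p, conj K (y p) ∂(spaceTime ℓ T) + (spaceTime ℓ T).real univ) := by
        rw [integral_const_mul, integral_add hyO.2 (integrable_const 1)]; simp
    _ ≤ _ := by gcongr

/-! ### Bounds for the optimal value -/

lemma isDualFeasible_zero (hF : IsAdmissibleFlux (L.Lam ℓ) F) (hκ : IsWeight κ T) :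
    IsDualFeasible L F κ T (fun _ : ℝ × Torus ℓ => 0) (fun _ => 0) where
  mem_orlicz := .of_bound hF.entropy_nFunction.isEvenConvex_conj aestronglyMeasurable_const
    (Eventually.of_forall fun _ => le_rfl)
  memLp _ _ := MemLp.zero
  symm := Eventually.of_forall fun _ => Matrix.isSymm_zero
  constraint Ψ _ := by simp [frob]
  posSemidef := by
    obtain ⟨a, ha, hab⟩ := hκ.lower
    filter_upwards [ae_spaceTime_mem (ℓ := ℓ) (T := T)] with p hp
    rw [smul_zero, add_zero]
    exact Matrix.PosSemidef.one.smul (ha.le.trans (hab _ (Ioo_subset_Icc_self hp)))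

/-- At the zero pair only ∫ κ tr M / 2 remains, and tr M ≥ tr F(z) ≥ tr F(0): the first by testing
with I ∈ Λ, the second since K ≥ 0. -/
lemma integral_weight_le_dualObjective_zero (hF : IsAdmissibleFlux (L.Lam ℓ) F) (hT : 0 < T)
    (hκ : IsWeight κ T) :
    (((∫ t in (0 : ℝ)..T, κ t) * (volume : Measure (Torus ℓ)).real univ
        * (F 0).trace / 2 : ℝ) : EReal)
      ≤ dualObjective L F κ T v₀ (fun _ => 0) (fun _ => 0) := by
  rw [le_dualObjective_iff]
  intro z M hzM
  have h1 : (∫ t in (0 : ℝ)..T, κ t) * (volume : Measure (Torus ℓ)).real univ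
      * (F 0).trace / 2 = ∫ p, κ p.1 * ((F 0).trace / 2) ∂(spaceTime ℓ T) := by
    unfold spaceTime
    rw [integral_prod_mul (fun t => κ t) (fun _ : Torus ℓ => (F 0).trace / 2),
      intervalIntegral.integral_of_le hT.le, integral_Ioc_eq_integral_Ioo]
    simp only [integral_const, smul_eq_mul]
    ring
  obtain ⟨b, -, -, hb⟩ := hκ.exists_abs_le (ℓ := ℓ)
  obtain ⟨a, ha, hab⟩ := hκ.lower
  rw [h1, lagrangian]
  simp only [inner_zero_right, integral_zero, neg_zero, zero_add]
  refine integral_mono_ae ?_ ?_ ?_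
  · exact Integrable.mul_const
      ((integrable_const b).mono' hκ.aestronglyMeasurable hb) _
  · exact integrable_frob (B := fun _ => 0) hκ hzM.integrable fun _ _ => MemLp.zero
  · filter_upwards [ae_spaceTime_mem (ℓ := ℓ) (T := T), hzM.flux_le] with p hp hle
    have h2 := hle.2 1 one_mem_Lam Matrix.PosSemidef.one
    rw [frob_sub_left, frob_one_right, frob_one_right, trace_flux] at h2
    rw [smul_zero, add_zero, frob_smul_right, frob_one_right]
    have h3 := hF.entropy_nFunction.nonneg (z p)
    have h4 : 0 ≤ κ p.1 := ha.le.trans (hab _ (Ioo_subset_Icc_self hp))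
    have h5 : (F 0).trace ≤ (M p).trace := by linarith
    have := mul_le_mul_of_nonneg_left h5 h4
    linarith

lemma dualObjective_le_dualValue (hEB : IsDualFeasible L F κ T E B) :
    dualObjective L F κ T v₀ E B ≤ dualValue L F κ T v₀ :=
  le_iSup_of_le E (le_iSup_of_le B (le_iSup_of_le hEB le_rfl))

/-- The competitor z = v₀ cancels the terms linear in E, leaving a bound independent of the feasible
pair. -/
lemma dualValue_lt_top (hF : IsAdmissibleFlux (L.Lam ℓ) F)
    (hL : StrongTrace ℓ L (entropy F)) (hT : 0 < T) (hκ : IsWeight κ T)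
    (hv₀ : MemOrlicz (entropy F) v₀ volume) : dualValue L F κ T v₀ < ⊤ := by
  obtain ⟨C, -, hC⟩ := exists_multiplier_trace_le hF hL hT hκ
  have hv : MemOrlicz (entropy F) (fun p : ℝ × Torus ℓ => v₀ p.2) (spaceTime ℓ T) :=
    memOrlicz_comp_snd hv₀
  refine lt_of_le_of_lt ?_ (EReal.coe_lt_top
    (C / 2 * ∫ p : ℝ × Torus ℓ, (F (v₀ p.2)).trace ∂(spaceTime ℓ T)))
  refine iSup_le fun E => iSup_le fun B => iSup_le fun hEB => ?_
  refine (dualObjective_le_lagrangian (isPrimalPair_trace hF hv)).trans ?_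
  rw [EReal.coe_le_coe_iff]
  have := lagrangian_trace_le hF hκ hv₀ hEB hv (hC E B hEB)
  simpa using this

end Coercivity

section Compactness

variable {d n N : ℕ} {ℓ : Fin d → ℝ} [∀ i, Fact (0 < ℓ i)] {T : ℝ} {L : DiffOp d n N}
  {F : Vec n → Mat N} {κ : ℝ → ℝ} {v₀ : Torus ℓ → Vec n}

/-! ### Convexity of the dual problem -/

lemma frob_smul_left (c : ℝ) (A B : Mat N) : frob (c • A) B = c * frob A B := by
  rw [frob_comm, frob_smul_right, frob_comm]

lemma frob_add_left (A B P : Mat N) : frob (A + B) P = frob A P + frob B P := by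
  rw [frob_comm, frob_add_right, frob_comm, frob_comm P]

section Test

variable {K : Vec n → ℝ} {E : ℝ × Torus ℓ → Vec n} {B : ℝ × Torus ℓ → Mat N}
  {Ψ : ℝ → Torus ℓ → Mat N}

lemma memOrlicz_apply_test (hK : IsEvenConvex K) (hΨ : IsTestField Ψ) :
    MemOrlicz K (fun p => L.apply (Ψ p.1) p.2) (spaceTime ℓ T) := by
  have hc := L.continuous_apply hΨ.smooth
  obtain ⟨R, hR⟩ := exists_bound_spaceTime (T := T) hc
  exact .of_bound hK hc.aestronglyMeasurable hR

lemma integrable_frob_timeDeriv (hB : ∀ l m, MemLp (fun p => B p l m) ∞ (spaceTime ℓ T))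
    (hΨ : IsTestField Ψ) :
    Integrable (fun p => frob (B p) (timeDeriv Ψ p.1 p.2)) (spaceTime ℓ T) := by
  refine integrable_finsetSum _ fun l _ => integrable_finsetSum _ fun m _ => ?_
  have hc := hΨ.continuous_timeDeriv l m
  obtain ⟨R, hR⟩ := exists_bound_spaceTime (T := T) hc
  exact ((hB l m).integrable le_top).mul_bdd hc.aestronglyMeasurable hR

lemma integrable_inner_test (hK : IsNFunction K) (hE : MemOrlicz (conj K) E (spaceTime ℓ T))
    (hΨ : IsTestField Ψ) :
    Integrable (fun p => inner ℝ (E p) (L.apply (Ψ p.1) p.2)) (spaceTime ℓ T) := by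
  exact (hK.integrable_inner (memOrlicz_apply_test hK.isEvenConvex hΨ) hE).congr
    (Eventually.of_forall fun p => real_inner_comm _ _)

end Test

variable {E₁ E₂ : ℝ × Torus ℓ → Vec n} {B₁ B₂ : ℝ × Torus ℓ → Mat N}

lemma IsDualFeasible.midpoint (hF : IsAdmissibleFlux (L.Lam ℓ) F)
    (h₁ : IsDualFeasible L F κ T E₁ B₁) (h₂ : IsDualFeasible L F κ T E₂ B₂) :
    IsDualFeasible L F κ T (fun p => (1 / 2 : ℝ) • (E₁ p + E₂ p))
      (fun p => (1 / 2 : ℝ) • (B₁ p + B₂ p)) where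
  mem_orlicz := h₁.mem_orlicz.midpoint hF.entropy_nFunction.isEvenConvex_conj h₂.mem_orlicz
  memLp l m := ((h₁.memLp l m).add (h₂.memLp l m)).const_mul (1 / 2)
  symm := by
    filter_upwards [h₁.symm, h₂.symm] with p h h'
    exact (h.add h').smul _
  constraint Ψ hΨ := by
    have hK := hF.entropy_nFunction
    have e₁ := h₁.constraint Ψ hΨ
    have e₂ := h₂.constraint Ψ hΨ
    have i₁ := (integrable_frob_timeDeriv h₁.memLp hΨ).add
      (integrable_inner_test (L := L) hK h₁.mem_orlicz hΨ)
    have i₂ := (integrable_frob_timeDeriv h₂.memLp hΨ).add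
      (integrable_inner_test (L := L) hK h₂.mem_orlicz hΨ)
    have h := integral_const_mul (μ := spaceTime ℓ T) (1 / 2 : ℝ) (fun p =>
      (frob (B₁ p) (timeDeriv Ψ p.1 p.2) + inner ℝ (E₁ p) (L.apply (Ψ p.1) p.2)) +
      (frob (B₂ p) (timeDeriv Ψ p.1 p.2) + inner ℝ (E₂ p) (L.apply (Ψ p.1) p.2)))
    have h' := integral_add i₁ i₂
    simp only [Pi.add_apply] at h'
    rw [h', e₁, e₂, add_zero, mul_zero] at h
    rw [← h]
    congr 1
    funext p
    simp only [frob_smul_left, frob_add_left, inner_smul_left, inner_add_left, conj_trivial]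
    ring
  posSemidef := by
    filter_upwards [h₁.posSemidef, h₂.posSemidef] with p h h'
    have := (h.add h').smul (show (0 : ℝ) ≤ 1 / 2 by norm_num)
    convert this using 1
    ext l m
    simp only [Matrix.add_apply, Matrix.smul_apply, smul_eq_mul]
    ring

lemma lagrangian_midpoint (hF : IsAdmissibleFlux (L.Lam ℓ) F) (hκ : IsWeight κ T)
    (hv₀ : MemOrlicz (entropy F) v₀ volume)
    (h₁ : IsDualFeasible L F κ T E₁ B₁) (h₂ : IsDualFeasible L F κ T E₂ B₂)
    {z : ℝ × Torus ℓ → Vec n} {M : ℝ × Torus ℓ → Mat N} (hzM : IsPrimalPair L F T z M) :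
    lagrangian κ T v₀ (fun p => (1 / 2 : ℝ) • (E₁ p + E₂ p)) (fun p => (1 / 2 : ℝ) • (B₁ p + B₂ p))
      z M = 1 / 2 * (lagrangian κ T v₀ E₁ B₁ z M + lagrangian κ T v₀ E₂ B₂ z M) := by
  have hK := hF.entropy_nFunction
  have hv : MemOrlicz (entropy F) (fun p : ℝ × Torus ℓ => v₀ p.2) (spaceTime ℓ T) :=
    memOrlicz_comp_snd hv₀
  have a₁ := hK.integrable_inner hv h₁.mem_orlicz
  have a₂ := hK.integrable_inner hv h₂.mem_orlicz
  have b₁ := (hK.integrable_inner hzM.mem_orlicz h₁.mem_orlicz).add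
    (integrable_frob hκ hzM.integrable h₁.memLp)
  have b₂ := (hK.integrable_inner hzM.mem_orlicz h₂.mem_orlicz).add
    (integrable_frob hκ hzM.integrable h₂.memLp)
  have ea : ∫ p, inner ℝ (v₀ p.2) ((1 / 2 : ℝ) • (E₁ p + E₂ p)) ∂(spaceTime ℓ T)
      = 1 / 2 * (∫ p, inner ℝ (v₀ p.2) (E₁ p) ∂(spaceTime ℓ T)
        + ∫ p, inner ℝ (v₀ p.2) (E₂ p) ∂(spaceTime ℓ T)) := by
    rw [← integral_add a₁ a₂, ← integral_const_mul]
    simp only [inner_smul_right, inner_add_right]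
  have eb : ∫ p, (inner ℝ (z p) ((1 / 2 : ℝ) • (E₁ p + E₂ p)) + frob (M p)
        (κ p.1 • (1 : Mat N) + (2 : ℝ) • (1 / 2 : ℝ) • (B₁ p + B₂ p)) / 2) ∂(spaceTime ℓ T)
      = 1 / 2 * (∫ p, (inner ℝ (z p) (E₁ p)
          + frob (M p) (κ p.1 • (1 : Mat N) + (2 : ℝ) • B₁ p) / 2) ∂(spaceTime ℓ T)
        + ∫ p, (inner ℝ (z p) (E₂ p)
          + frob (M p) (κ p.1 • (1 : Mat N) + (2 : ℝ) • B₂ p) / 2) ∂(spaceTime ℓ T)) := by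
    have hab := integral_add b₁ b₂
    simp only [Pi.add_apply] at hab
    rw [← hab, ← integral_const_mul]
    congr 1
    funext p
    simp only [inner_smul_right, inner_add_right, frob_add_right, frob_smul_right]
    ring
  rw [lagrangian, lagrangian, lagrangian, ea, eb]
  ring

/-! ### Limits of feasible pairs -/

section Limits

variable {E : ℕ → ℝ × Torus ℓ → Vec n} {B : ℕ → ℝ × Torus ℓ → Mat N}
  {E' : ℝ × Torus ℓ → Vec n} {B' : ℝ × Torus ℓ → Mat N}

/-- Fatou's lemma for the modular. -/
lemma memOrlicz_of_tendsto {Q : Type*} [MeasurableSpace Q] {μ : Measure Q} {K : Vec n → ℝ}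
    (hK : IsEvenConvex K) {f : ℕ → Q → Vec n} {g : Q → Vec n} (hf : ∀ k, MemOrlicz K (f k) μ)
    (hg : AEStronglyMeasurable g μ) {C : ℝ} (hC : ∀ k, ∫ q, K (f k q) ∂μ ≤ C)
    (hlim : ∀ᵐ q ∂μ, Tendsto (fun k => f k q) atTop (𝓝 (g q))) : MemOrlicz K g μ := by
  refine ⟨hg, hK.continuous.comp_aestronglyMeasurable hg, ?_⟩
  have h1 : ∫⁻ q, ‖K (g q)‖ₑ ∂μ ≤ ∫⁻ q, liminf (fun k => ‖K (f k q)‖ₑ) atTop ∂μ := by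
    refine lintegral_mono_ae (hlim.mono fun q hq => ?_)
    have := ((hK.continuous.tendsto _).comp hq).enorm
    exact this.liminf_eq.ge
  refine lt_of_le_of_lt (h1.trans (lintegral_liminf_le' fun k => (hf k).2.1.enorm)) ?_
  refine lt_of_le_of_lt (liminf_le_of_frequently_le'
    (Eventually.frequently (Eventually.of_forall fun k => ?_))) (ENNReal.ofReal_lt_top (r := C))
  rw [← ofReal_integral_norm_eq_lintegral_enorm (hf k).2]
  refine ENNReal.ofReal_le_ofReal (le_trans (le_of_eq ?_) (hC k))
  exact integral_congr_ae (Eventually.of_forall fun q => Real.norm_of_nonneg (hK.nonneg _))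

lemma tendsto_integral_frob {X : Type*} [MeasurableSpace X] {μ : Measure X}
    {A : X → Mat N} {B : ℕ → X → Mat N} {B' : X → Mat N}
    (hA : ∀ l m, Integrable (fun p => A p l m) μ)
    (hB : ∀ k l m, AEStronglyMeasurable (fun p => B k p l m) μ) {R : ℝ}
    (hR : ∀ k, ∀ᵐ p ∂μ, ∀ l m, |B k p l m| ≤ R)
    (hlim : ∀ᵐ p ∂μ, ∀ l m, Tendsto (fun k => B k p l m) atTop (𝓝 (B' p l m))) :
    Tendsto (fun k => ∫ p, frob (A p) (B k p) ∂μ) atTop (𝓝 (∫ p, frob (A p) (B' p) ∂μ)) := by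
  refine tendsto_integral_of_dominated_convergence (fun p => ∑ l, ∑ m, ‖A p l m‖ * R)
    (fun k => ?_) ?_ (fun k => ?_) ?_
  · refine Finset.aestronglyMeasurable_fun_sum _ fun l _ =>
      Finset.aestronglyMeasurable_fun_sum _ fun m _ => (hA l m).1.mul (hB k l m)
  · exact integrable_finsetSum _ fun l _ => integrable_finsetSum _ fun m _ =>
      (hA l m).norm.mul_const R
  · filter_upwards [hR k] with p hp
    refine (norm_sum_le _ _).trans (Finset.sum_le_sum fun l _ => ?_)
    refine (norm_sum_le _ _).trans (Finset.sum_le_sum fun m _ => ?_)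
    rw [norm_mul]
    exact mul_le_mul_of_nonneg_left (hp l m) (norm_nonneg _)
  · filter_upwards [hlim] with p hp
    exact tendsto_finsetSum _ fun l _ => tendsto_finsetSum _ fun m _ => (hp l m).const_mul _

/-- Feasibility is preserved under almost everywhere limits of bounded sequences. -/
lemma IsDualFeasible.of_tendsto (hF : IsAdmissibleFlux (L.Lam ℓ) F)
    (hEB : ∀ k, IsDualFeasible L F κ T (E k) (B k)) {C R : ℝ}
    (hC : ∀ k, ∫ p, conj (entropy F) (E k p) ∂(spaceTime ℓ T) ≤ C)
    (hR : ∀ k, ∀ᵐ p ∂(spaceTime ℓ T), ∀ l m, |B k p l m| ≤ R)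
    (hEm : AEStronglyMeasurable E' (spaceTime ℓ T))
    (hBm : ∀ l m, AEStronglyMeasurable (fun p => B' p l m) (spaceTime ℓ T))
    (hE : ∀ᵐ p ∂(spaceTime ℓ T), Tendsto (fun k => E k p) atTop (𝓝 (E' p)))
    (hB : ∀ᵐ p ∂(spaceTime ℓ T), ∀ l m, Tendsto (fun k => B k p l m) atTop (𝓝 (B' p l m))) :
    IsDualFeasible L F κ T E' B' := by
  have hK := hF.entropy_nFunction
  have hE' : MemOrlicz (conj (entropy F)) E' (spaceTime ℓ T) :=
    memOrlicz_of_tendsto hK.isEvenConvex_conj (fun k => (hEB k).mem_orlicz) hEm hC hE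
  have hB'L : ∀ l m, MemLp (fun p => B' p l m) ∞ (spaceTime ℓ T) := fun l m => by
    refine MemLp.of_bound (hBm l m) R ?_
    filter_upwards [ae_all_iff.2 hR, hB] with p h1 h2
    exact le_of_tendsto (h2 l m).norm (Eventually.of_forall fun k => h1 k l m)
  refine ⟨hE', hB'L, ?_, fun Ψ hΨ => ?_, ?_⟩
  · filter_upwards [ae_all_iff.2 fun k => (hEB k).symm, hB] with p h1 h2
    ext l m
    refine tendsto_nhds_unique (h2 m l) ((h2 l m).congr fun k => ?_)
    exact ((h1 k).apply l m).symm
  · have hA : ∀ l m, Integrable (fun p : ℝ × Torus ℓ => timeDeriv Ψ p.1 p.2 l m)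
        (spaceTime ℓ T) := fun l m => by
      have hc := hΨ.continuous_timeDeriv l m
      obtain ⟨R, hR⟩ := exists_bound_spaceTime (T := T) hc
      exact (integrable_const R).mono' hc.aestronglyMeasurable hR
    have t1 := tendsto_integral_frob hA (fun k l m => ((hEB k).memLp l m).1) hR hB
    have t2 := hK.tendsto_integral_inner hF.entropy_delta2
      (memOrlicz_apply_test (L := L) hK.isEvenConvex hΨ) (fun k => (hEB k).mem_orlicz) hE' C hC hE
    have t3 := t1.add t2
    have e : ∀ (E : ℝ × Torus ℓ → Vec n) (B : ℝ × Torus ℓ → Mat N),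
        MemOrlicz (conj (entropy F)) E (spaceTime ℓ T) →
        (∀ l m, MemLp (fun p => B p l m) ∞ (spaceTime ℓ T)) →
        ∫ p, frob (timeDeriv Ψ p.1 p.2) (B p) ∂(spaceTime ℓ T)
          + ∫ p, inner ℝ (L.apply (Ψ p.1) p.2) (E p) ∂(spaceTime ℓ T)
        = ∫ p, (frob (B p) (timeDeriv Ψ p.1 p.2) + inner ℝ (E p) (L.apply (Ψ p.1) p.2))
          ∂(spaceTime ℓ T) := by
      intro E B hE hB
      rw [integral_add (integrable_frob_timeDeriv hB hΨ) (integrable_inner_test hK hE hΨ)]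
      congr 1
      · simp_rw [frob_comm]
      · simp_rw [real_inner_comm]
    rw [← e E' B' hE' hB'L]
    refine tendsto_nhds_unique t3 (tendsto_const_nhds.congr fun k => ?_)
    rw [e _ _ (hEB k).mem_orlicz (hEB k).memLp, (hEB k).constraint Ψ hΨ]
  · filter_upwards [ae_all_iff.2 fun k => (hEB k).posSemidef,
      ae_all_iff.2 fun k => (hEB k).symm, hB] with p h1 h3 h2
    have hs : (B' p).IsSymm := by
      ext l m
      refine tendsto_nhds_unique (h2 m l) ((h2 l m).congr fun k => ?_)
      exact ((h3 k).apply l m).symm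
    refine Matrix.PosSemidef.of_dotProduct_mulVec_nonneg
      (isHermitian_of_isSymm ((Matrix.isSymm_one.smul _).add (hs.smul _))) fun v => ?_
    have ht : Tendsto (fun k => star v ⬝ᵥ (κ p.1 • (1 : Mat N) + (2 : ℝ) • B k p).mulVec v) atTop
        (𝓝 (star v ⬝ᵥ (κ p.1 • (1 : Mat N) + (2 : ℝ) • B' p).mulVec v)) := by
      simp only [dotProduct, Matrix.mulVec, Matrix.add_apply, Matrix.smul_apply, smul_eq_mul]
      exact tendsto_finsetSum _ fun l _ => (tendsto_finsetSum _ fun m _ =>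
        (((h2 l m).const_mul 2).const_add _).mul_const _).const_mul _
    exact ge_of_tendsto' ht fun k => (h1 k).dotProduct_mulVec_nonneg v

/-- The pairings of E with v₀ and z converge by the modular bound, and the matrix term by domination
with |M| times a constant. -/
lemma tendsto_lagrangian (hF : IsAdmissibleFlux (L.Lam ℓ) F) (hκ : IsWeight κ T)
    (hv₀ : MemOrlicz (entropy F) v₀ volume)
    (hEB : ∀ k, IsDualFeasible L F κ T (E k) (B k)) (hEB' : IsDualFeasible L F κ T E' B') {C R : ℝ}
    (hC : ∀ k, ∫ p, conj (entropy F) (E k p) ∂(spaceTime ℓ T) ≤ C)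
    (hR : ∀ k, ∀ᵐ p ∂(spaceTime ℓ T), ∀ l m, |B k p l m| ≤ R)
    (hE : ∀ᵐ p ∂(spaceTime ℓ T), Tendsto (fun k => E k p) atTop (𝓝 (E' p)))
    (hB : ∀ᵐ p ∂(spaceTime ℓ T), ∀ l m, Tendsto (fun k => B k p l m) atTop (𝓝 (B' p l m)))
    {z : ℝ × Torus ℓ → Vec n} {M : ℝ × Torus ℓ → Mat N} (hzM : IsPrimalPair L F T z M) :
    Tendsto (fun k => lagrangian κ T v₀ (E k) (B k) z M) atTop
      (𝓝 (lagrangian κ T v₀ E' B' z M)) := by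
  have hK := hF.entropy_nFunction
  have hv : MemOrlicz (entropy F) (fun p : ℝ × Torus ℓ => v₀ p.2) (spaceTime ℓ T) :=
    memOrlicz_comp_snd hv₀
  obtain ⟨b, hb0, -, hb⟩ := hκ.exists_abs_le (ℓ := ℓ)
  have t1 := hK.tendsto_integral_inner hF.entropy_delta2 hv (fun k => (hEB k).mem_orlicz)
    hEB'.mem_orlicz C hC hE
  have t2 := hK.tendsto_integral_inner hF.entropy_delta2 hzM.mem_orlicz
    (fun k => (hEB k).mem_orlicz) hEB'.mem_orlicz C hC hE
  have t3 := tendsto_integral_frob (μ := spaceTime ℓ T)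
    (B := fun k p => κ p.1 • (1 : Mat N) + (2 : ℝ) • B k p)
    (B' := fun p => κ p.1 • (1 : Mat N) + (2 : ℝ) • B' p) (R := b + 2 * R) hzM.integrable
    (fun k l m => (hκ.aestronglyMeasurable.mul_const _).add (((hEB k).memLp l m).1.const_mul 2))
    (fun k => by
      filter_upwards [hb, hR k] with p h1 h2 l m
      simp only [Matrix.add_apply, Matrix.smul_apply, smul_eq_mul]
      refine (abs_add_le _ _).trans (add_le_add ?_ ?_)
      · rw [abs_mul]
        refine (mul_le_of_le_one_right (abs_nonneg _) ?_).trans h1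
        rw [Matrix.one_apply]
        split_ifs <;> simp
      · rw [abs_mul, abs_of_pos (zero_lt_two' ℝ)]
        exact mul_le_mul_of_nonneg_left (h2 l m) zero_le_two)
    (hB.mono fun p hp l m => ((hp l m).const_mul 2).const_add _)
  have t4 := t1.neg.add (t2.add (t3.div_const 2))
  have e : ∀ (E : ℝ × Torus ℓ → Vec n) (B : ℝ × Torus ℓ → Mat N), IsDualFeasible L F κ T E B →
      lagrangian κ T v₀ E B z M = -∫ p, inner ℝ (v₀ p.2) (E p) ∂(spaceTime ℓ T)
        + (∫ p, inner ℝ (z p) (E p) ∂(spaceTime ℓ T)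
        + (∫ p, frob (M p) (κ p.1 • (1 : Mat N) + (2 : ℝ) • B p) ∂(spaceTime ℓ T)) / 2) := by
    intro E B h
    rw [lagrangian, integral_add (hK.integrable_inner hzM.mem_orlicz h.mem_orlicz)
      (integrable_frob hκ hzM.integrable h.memLp), integral_div]
  rw [e _ _ hEB']
  exact t4.congr fun k => (e _ _ (hEB k)).symm

end Limits

end Compactness

section Existence

variable {d n N : ℕ} {ℓ : Fin d → ℝ} [∀ i, Fact (0 < ℓ i)] {T : ℝ} {L : DiffOp d n N}
  {F : Vec n → Mat N} {κ : ℝ → ℝ} {v₀ : Torus ℓ → Vec n}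

/-! ### Existence of maximizers -/

/-- The Hilbert space of values of the pairs `(E,B)`. -/
abbrev PairSpace (n N : ℕ) : Type := WithLp 2 (Vec n × EuclideanSpace ℝ (Fin N × Fin N))

/-- The matrix component of a value of a pair. -/
def PairSpace.mat (w : PairSpace n N) : Mat N := Matrix.of fun l m => w.snd (l, m)

/-- The value of a pair with given components. -/
def PairSpace.mk (y : Vec n) (A : Mat N) : PairSpace n N :=
  WithLp.toLp 2 (y, WithLp.toLp 2 fun q => A q.1 q.2)

lemma PairSpace.continuous_mat_apply (l m : Fin N) :
    Continuous fun w : PairSpace n N => w.mat l m := by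
  unfold PairSpace.mat
  simp only [Matrix.of_apply]
  exact (EuclideanSpace.proj (𝕜 := ℝ) (l, m)).continuous.comp (WithLp.continuous_snd 2 _ _)

lemma PairSpace.norm_le (w : PairSpace n N) : ‖w‖ ≤ ‖w.fst‖ + ∑ q : Fin N × Fin N, |w.mat q.1 q.2| := by
  have h1 : ‖w‖ ≤ ‖w.fst‖ + ‖w.snd‖ := by
    rw [WithLp.prod_norm_eq_of_L2]
    refine Real.sqrt_le_iff.2 ⟨by positivity, ?_⟩
    nlinarith [norm_nonneg w.fst, norm_nonneg w.snd]
  have h2 : ‖w.snd‖ ≤ ∑ q : Fin N × Fin N, |w.mat q.1 q.2| := by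
    rw [EuclideanSpace.norm_eq]
    refine Real.sqrt_le_iff.2 ⟨Finset.sum_nonneg fun _ _ => abs_nonneg _, ?_⟩
    exact Finset.sum_sq_le_sq_sum_of_nonneg fun q _ => abs_nonneg _
  linarith

lemma PairSpace.aestronglyMeasurable_mk {X : Type*} [MeasurableSpace X] {μ : Measure X}
    {E : X → Vec n} {B : X → Mat N} (hE : AEStronglyMeasurable E μ)
    (hB : ∀ l m, AEStronglyMeasurable (fun p => B p l m) μ) :
    AEStronglyMeasurable (fun p => PairSpace.mk (E p) (B p)) μ := by
  have h1 : AEMeasurable (fun p => fun q : Fin N × Fin N => B p q.1 q.2) μ :=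
    aemeasurable_pi_iff.2 fun q => (hB q.1 q.2).aemeasurable
  have h2 : AEStronglyMeasurable (fun p => (WithLp.toLp 2 fun q : Fin N × Fin N => B p q.1 q.2 :
      EuclideanSpace ℝ (Fin N × Fin N))) μ :=
    (PiLp.continuous_toLp 2 _).comp_aestronglyMeasurable h1.aestronglyMeasurable
  exact (WithLp.prod_continuous_toLp 2 _ _).comp_aestronglyMeasurable (hE.prodMk h2)

/-- Near-maximizers of the dual problem. -/
def superlevel (L : DiffOp d n N) (F : Vec n → Mat N) (κ : ℝ → ℝ) (T : ℝ) (v₀ : Torus ℓ → Vec n)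
    (c : ℝ) : Set (ℝ × Torus ℓ → PairSpace n N) :=
  {f | AEStronglyMeasurable f (spaceTime ℓ T) ∧
    IsDualFeasible L F κ T (fun p => (f p).fst) (fun p => (f p).mat) ∧
    (c : EReal) ≤ dualObjective L F κ T v₀ (fun p => (f p).fst) (fun p => (f p).mat)}

lemma superlevel_midpoint (hF : IsAdmissibleFlux (L.Lam ℓ) F) (hκ : IsWeight κ T)
    (hv₀ : MemOrlicz (entropy F) v₀ volume) {c : ℝ} {f g : ℝ × Torus ℓ → PairSpace n N}
    (hf : f ∈ superlevel L F κ T v₀ c) (hg : g ∈ superlevel L F κ T v₀ c) :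
    (fun p => (1 / 2 : ℝ) • (f p + g p)) ∈ superlevel L F κ T v₀ c := by
  obtain ⟨hfm, hff, hfo⟩ := hf
  obtain ⟨hgm, hgf, hgo⟩ := hg
  rw [le_dualObjective_iff] at hfo hgo
  have e1 : (fun p => ((1 / 2 : ℝ) • (f p + g p)).fst)
      = fun p => (1 / 2 : ℝ) • ((f p).fst + (g p).fst) := by
    funext p; simp
  have e2 : (fun p => ((1 / 2 : ℝ) • (f p + g p) : PairSpace n N).mat)
      = fun p => (1 / 2 : ℝ) • ((f p).mat + (g p).mat) := by
    funext p; ext l m; simp [PairSpace.mat, mul_add]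
  refine ⟨(hfm.add hgm).const_smul (1 / 2 : ℝ), ?_, ?_⟩
  · rw [e1, e2]
    exact hff.midpoint hF hgf
  · rw [e1, e2, le_dualObjective_iff]
    intro z M hzM
    rw [lagrangian_midpoint hF hκ hv₀ hff hgf hzM]
    linarith [hfo z M hzM, hgo z M hzM]

lemma superlevel_nonempty {c : ℝ} (hc : (c : EReal) < dualValue L F κ T v₀) :
    (superlevel L F κ T v₀ c).Nonempty := by
  unfold dualValue at hc
  obtain ⟨E, hc⟩ := lt_iSup_iff.1 hc
  obtain ⟨B, hc⟩ := lt_iSup_iff.1 hc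
  obtain ⟨hEB, hc⟩ := lt_iSup_iff.1 hc
  exact ⟨fun p => PairSpace.mk (E p) (B p), PairSpace.aestronglyMeasurable_mk hEB.mem_orlicz.1
    fun l m => (hEB.memLp l m).1, hEB, hc.le⟩

/-- The norm of E is at most K*(E) plus a constant, and B is uniformly bounded; this is the L¹ bound
that the selection theorem requires. -/
lemma exists_superlevel_bound (hF : IsAdmissibleFlux (L.Lam ℓ) F)
    (hL : StrongTrace ℓ L (entropy F)) (hT : 0 < T) (hκ : IsWeight κ T)
    (hv₀ : MemOrlicz (entropy F) v₀ volume) (c : ℝ) :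
    ∃ C, ∀ f ∈ superlevel L F κ T v₀ c, Integrable f (spaceTime ℓ T) ∧
      ∫ p, ‖f p‖ ∂(spaceTime ℓ T) ≤ C := by
  have hK := hF.entropy_nFunction
  obtain ⟨C, hC⟩ := exists_integral_conj_le hF hL hT hκ hv₀ c
  obtain ⟨R, hR⟩ := exists_abs_apply_le hF hL hT hκ
  obtain ⟨A, -, hA⟩ := hK.exists_norm_le_conj
  set S := A + ∑ _q : Fin N × Fin N, R with hS
  refine ⟨C + S * (spaceTime ℓ T).real univ, fun f hf => ?_⟩
  obtain ⟨hfm, hff, hfo⟩ := hf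
  have hi : Integrable (fun p => conj (entropy F) (f p).fst + S) (spaceTime ℓ T) :=
    hff.mem_orlicz.2.add (integrable_const S)
  have hb : ∀ᵐ p ∂(spaceTime ℓ T), ‖f p‖ ≤ conj (entropy F) (f p).fst + S := by
    filter_upwards [hR _ _ hff] with p hp
    have h1 := (f p).norm_le
    have h2 := Finset.sum_le_sum fun (q : Fin N × Fin N) (_ : q ∈ Finset.univ) => hp q.1 q.2
    have h3 := hA (f p).fst
    linarith
  have hfi : Integrable f (spaceTime ℓ T) := hi.mono' hfm hb
  refine ⟨hfi, (integral_mono_ae hfi.norm hi hb).trans ?_⟩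
  rw [integral_add hff.mem_orlicz.2 (integrable_const S)]
  refine add_le_add (hC _ _ hff hfo) (le_of_eq ?_)
  simp [mul_comm]

theorem exists_maximizer (hF : IsAdmissibleFlux (L.Lam ℓ) F)
    (hL : StrongTrace ℓ L (entropy F)) (hT : 0 < T) (hκ : IsWeight κ T)
    (hv₀ : MemOrlicz (entropy F) v₀ volume) :
    ∃ (E : ℝ × Torus ℓ → Vec n) (B : ℝ × Torus ℓ → Mat N), IsDualFeasible L F κ T E B ∧
      dualObjective L F κ T v₀ E B = dualValue L F κ T v₀ := by
  have hbot : dualValue L F κ T v₀ ≠ ⊥ := by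
    refine ne_bot_of_le_ne_bot (EReal.coe_ne_bot _)
      ((integral_weight_le_dualObjective_zero (v₀ := v₀) hF hT hκ).trans
        (dualObjective_le_dualValue (isDualFeasible_zero hF hκ)))
  have htop := (dualValue_lt_top hF hL hT hκ hv₀).ne
  set J := (dualValue L F κ T v₀).toReal
  have hJ : (J : EReal) = dualValue L F κ T v₀ := EReal.coe_toReal htop hbot
  -- Levels strictly below the optimal value, so that all superlevel sets are nonempty, and
  -- increasing to it.
  set c : ℕ → ℝ := fun k => J - 1 / ((k : ℝ) + 1) with hc
  have hcmono : Monotone c := fun i j hij => sub_le_sub_left (Nat.one_div_le_one_div hij) J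
  set S : ℕ → Set (ℝ × Torus ℓ → PairSpace n N) := fun k => superlevel L F κ T v₀ (c k)
  have hanti : Antitone S := fun i j hij f hf =>
    ⟨hf.1, hf.2.1, (EReal.coe_le_coe_iff.2 (hcmono hij)).trans hf.2.2⟩
  obtain ⟨C, hC⟩ := exists_superlevel_bound hF hL hT hκ hv₀ (c 0)
  obtain ⟨f, g, hfS, hg, hlim⟩ := exists_seq_mem_tendsto_ae (μ := spaceTime ℓ T) S hanti
    (fun k => superlevel_nonempty (by
      rw [← hJ, EReal.coe_lt_coe_iff]
      linarith [Nat.one_div_pos_of_nat (α := ℝ) (n := k)]))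
    (fun k f hf g hg => superlevel_midpoint hF hκ hv₀ hf hg)
    (fun f hf => (hC f hf).1) C (fun f hf => (hC f hf).2)
  obtain ⟨C', hC'⟩ := exists_integral_conj_le hF hL hT hκ hv₀ (c 0)
  obtain ⟨R, hR⟩ := exists_abs_apply_le hF hL hT hκ
  have hfeas := fun k => (hfS k).2.1
  have hfC := fun k => hC' _ _ (hfeas k) (hanti (Nat.zero_le k) (hfS k)).2.2
  have hfR := fun k => hR _ _ (hfeas k)
  have hE : ∀ᵐ p ∂(spaceTime ℓ T), Tendsto (fun k => (f k p).fst) atTop (𝓝 (g p).fst) :=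
    hlim.mono fun p hp => ((WithLp.continuous_fst 2 _ _).tendsto _).comp hp
  have hB : ∀ᵐ p ∂(spaceTime ℓ T), ∀ l m,
      Tendsto (fun k => (f k p).mat l m) atTop (𝓝 ((g p).mat l m)) :=
    hlim.mono fun p hp l m => ((PairSpace.continuous_mat_apply l m).tendsto _).comp hp
  have hgf : IsDualFeasible L F κ T (fun p => (g p).fst) (fun p => (g p).mat) :=
    .of_tendsto hF hfeas hfC hfR
      ((WithLp.continuous_fst 2 _ _).comp_aestronglyMeasurable hg.aestronglyMeasurable)
      (fun l m => (PairSpace.continuous_mat_apply l m).comp_aestronglyMeasurable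
        hg.aestronglyMeasurable) hE hB
  refine ⟨_, _, hgf, le_antisymm (dualObjective_le_dualValue hgf) ?_⟩
  rw [← hJ, le_dualObjective_iff]
  intro z M hzM
  have h1 := tendsto_lagrangian hF hκ hv₀ hfeas hgf hfC hfR hE hB hzM
  have h2 : Tendsto c atTop (𝓝 J) := by
    simpa [hc] using (tendsto_one_div_add_atTop_nhds_zero_nat (𝕜 := ℝ)).const_sub J
  -- For fixed (z,M) the Lagrangian at stage k is at least `c k`; passing to the limit before taking
  -- the infimum gives upper semicontinuity.
  exact le_of_tendsto_of_tendsto' h2 h1 fun k => (le_dualObjective_iff _).1 (hfS k).2.2 z M hzM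

end Existence

end DualOrlicz

end



theorem mainTheorem3 {d n N : ℕ} (ℓ : Fin d → ℝ) [∀ i, Fact (0 < ℓ i)]
    (L : DualOrlicz.DiffOp d n N) (F : DualOrlicz.Vec n → DualOrlicz.Mat N)
    (hF : DualOrlicz.IsAdmissibleFlux (L.Lam ℓ) F)
    (hL : DualOrlicz.StrongTrace ℓ L (DualOrlicz.entropy F))
    (T : ℝ) (hT : 0 < T) (κ : ℝ → ℝ) (hκ : DualOrlicz.IsWeight κ T)
    (v₀ : DualOrlicz.Torus ℓ → DualOrlicz.Vec n)
    (hv₀ : DualOrlicz.MemOrlicz (DualOrlicz.entropy F) v₀ volume) :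
    (∃ (E : ℝ × DualOrlicz.Torus ℓ → DualOrlicz.Vec n)
        (B : ℝ × DualOrlicz.Torus ℓ → DualOrlicz.Mat N),
      DualOrlicz.IsDualFeasible L F κ T E B ∧
      DualOrlicz.dualObjective L F κ T v₀ E B = DualOrlicz.dualValue L F κ T v₀) ∧
    0 ≤ (∫ t in (0 : ℝ)..T, κ t) * (volume : Measure (DualOrlicz.Torus ℓ)).real univ
        * (F 0).trace / 2 ∧
    (((∫ t in (0 : ℝ)..T, κ t) * (volume : Measure (DualOrlicz.Torus ℓ)).real univ
        * (F 0).trace / 2 : ℝ) : EReal) ≤ DualOrlicz.dualValue L F κ T v₀ ∧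
    DualOrlicz.dualValue L F κ T v₀ < ⊤ := by
  refine ⟨DualOrlicz.exists_maximizer hF hL hT hκ hv₀, ?_,
    (DualOrlicz.integral_weight_le_dualObjective_zero hF hT hκ).trans
      (DualOrlicz.dualObjective_le_dualValue (DualOrlicz.isDualFeasible_zero hF hκ)),
    DualOrlicz.dualValue_lt_top hF hL hT hκ hv₀⟩
  obtain ⟨a, ha, hab⟩ := hκ.lower
  have h1 : 0 ≤ ∫ t in (0 : ℝ)..T, κ t :=
    intervalIntegral.integral_nonneg hT.le fun t ht => ha.le.trans (hab t ht)
  have h2 := DualOrlicz.trace_flux_nonneg hF 0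
  positivity
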